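/- Consider tables with $c$ columns of cardinalities $N_1,\dots,N_c$, where $2\le N_i\le 30$ for all $i$ and $N_1\le N_2\le\dots\le N_c$; the values of column $i$ are coded as $0,1,\dots,N_i-1$. Let $0\le p\le 1$, and let $T$ be a random table (a set of distinct rows) in which each of the $N_1N_2\cdots N_c$ possible rows is present with probability $p$, independently of the other rows. For a permutation $\sigma$ of $\{1,\dots,c\}$, rearrange the columns of $T$ into the order $\sigma(1),\dots,\sigma(c)$ and then sort the rows in reflected Gray-code order: two different rows $u,v$ of the rearranged table are compared at the first position $j$ where they differ, and $u$ precedes $v$ if either $u_1+\dots+u_{j-1}$ is even and $u_j<v_j$, or $u_1+\dots+u_{j-1}$ is odd and $u_j>v_j$. Let $R_\sigma$ be the expected total number of column runs of the sorted table, that is, the expectation of the sum over all columns of the number of maximal blocks of consecutive equal entries in that column. Then the column order by increasing cardinality minimizes the expected number of column runs up to an additive term of at most $c$: for every permutation $\sigma$, $$R_{\mathrm{id}}\le R_\sigma+c .$$ -/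

import Mathlib

namespace GrayRuns

/-- The possible rows of a table with `c` columns of cardinalities `N 0, …, N (c - 1)`;
the values of column `i` are coded as `0, …, N i - 1`. -/
abbrev Row {c : ℕ} (N : Fin c → ℕ) : Type := (i : Fin c) → Fin (N i)

/-- The strict (mixed-radix) reflected Gray-code order, in which every digit goes up and down
alternately: compare two rows at the first column `j` where they differ, upwards if the sum of the
preceding digits is even and downwards if it is odd. -/
def GrayLT {c : ℕ} {N : Fin c → ℕ} (s t : Row N) : Prop :=
  ∃ j, (∀ i < j, s i = t i) ∧
    if Even (∑ i ∈ Finset.Iio j, (s i : ℕ)) then s j < t j else t j < s j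

/-- The reflected Gray-code order. -/
def GrayLE {c : ℕ} {N : Fin c → ℕ} (s t : Row N) : Prop := s = t ∨ GrayLT s t

instance {c : ℕ} {N : Fin c → ℕ} : DecidableRel (GrayLT (N := N)) := fun s t => by
  unfold GrayLT; infer_instance

instance {c : ℕ} {N : Fin c → ℕ} : DecidableRel (GrayLE (N := N)) := fun s t => by
  unfold GrayLE; infer_instance

theorem sum_Iio_congr {c : ℕ} {N : Fin c → ℕ} {s t : Row N} {j : Fin c}
    (h : ∀ i < j, s i = t i) :
    ∑ i ∈ Finset.Iio j, (s i : ℕ) = ∑ i ∈ Finset.Iio j, (t i : ℕ) :=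
  Finset.sum_congr rfl fun i hi => by rw [h i (Finset.mem_Iio.mp hi)]

theorem GrayLT.trans {c : ℕ} {N : Fin c → ℕ} {s t u : Row N}
    (h₁ : GrayLT s t) (h₂ : GrayLT t u) : GrayLT s u := by
  obtain ⟨j, hj, hj'⟩ := h₁
  obtain ⟨k, hk, hk'⟩ := h₂
  rcases lt_trichotomy j k with h | h | h
  · refine ⟨j, fun i hi => (hj i hi).trans (hk i (hi.trans h)), ?_⟩
    rwa [← hk j h]
  · subst h
    refine ⟨j, fun i hi => (hj i hi).trans (hk i hi), ?_⟩
    rw [← sum_Iio_congr hj] at hk'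
    split_ifs at hj' hk' ⊢
    · exact hj'.trans hk'
    · exact hk'.trans hj'
  · refine ⟨k, fun i hi => (hj i (hi.trans h)).trans (hk i hi), ?_⟩
    rw [← sum_Iio_congr fun i hi => hj i (hi.trans h)] at hk'
    rwa [hj k h]

theorem GrayLT.irrefl {c : ℕ} {N : Fin c → ℕ} (s : Row N) : ¬ GrayLT s s := by
  rintro ⟨j, -, h⟩
  split_ifs at h <;> exact lt_irrefl _ h

theorem GrayLT.total {c : ℕ} {N : Fin c → ℕ} {s t : Row N} (h : s ≠ t) :
    GrayLT s t ∨ GrayLT t s := by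
  have hne : (Finset.univ.filter fun i => s i ≠ t i).Nonempty := by
    obtain ⟨i, hi⟩ := Function.ne_iff.mp h
    exact ⟨i, by simpa using hi⟩
  set j := (Finset.univ.filter fun i => s i ≠ t i).min' hne with hjdef
  have hj : s j ≠ t j := (Finset.mem_filter.mp (Finset.min'_mem _ hne)).2
  have hlt : ∀ i < j, s i = t i := fun i hi => by
    by_contra hc
    exact absurd (Finset.min'_le _ i (by simpa using hc)) (not_le.mpr hi)
  by_cases he : Even (∑ i ∈ Finset.Iio j, (s i : ℕ))
  · have he' := he
    rw [sum_Iio_congr hlt] at he'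
    rcases lt_or_gt_of_ne hj with h' | h'
    · exact Or.inl ⟨j, hlt, by rwa [if_pos he]⟩
    · exact Or.inr ⟨j, fun i hi => (hlt i hi).symm, by rwa [if_pos he']⟩
  · have he' := he
    rw [sum_Iio_congr hlt] at he'
    rcases lt_or_gt_of_ne hj with h' | h'
    · exact Or.inr ⟨j, fun i hi => (hlt i hi).symm, by rwa [if_neg he']⟩
    · exact Or.inl ⟨j, hlt, by rwa [if_neg he]⟩

instance {c : ℕ} {N : Fin c → ℕ} : IsTrans (Row N) GrayLE where
  trans := by
    rintro s t u (rfl | h₁) (rfl | h₂)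
    · exact Or.inl rfl
    · exact Or.inr h₂
    · exact Or.inr h₁
    · exact Or.inr (h₁.trans h₂)

instance {c : ℕ} {N : Fin c → ℕ} : Std.Antisymm (GrayLE (N := N)) where
  antisymm := by
    rintro s t (rfl | h₁) (h₂ | h₂)
    · rfl
    · rfl
    · exact h₂.symm
    · exact absurd (h₁.trans h₂) (GrayLT.irrefl s)

instance {c : ℕ} {N : Fin c → ℕ} : Std.Total (GrayLE (N := N)) where
  total s t := by
    by_cases h : s = t
    · exact Or.inl (Or.inl h)
    · exact (GrayLT.total h).imp Or.inr Or.inr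

/-- The number of runs (maximal blocks of consecutive equal entries) of a list. -/
def runs {α : Type*} [DecidableEq α] (l : List α) : ℕ := (l.destutter (· ≠ ·)).length

/-- The number of column runs of a table whose rows are listed in reflected Gray-code order:
the sum over all columns of the number of runs in that column. -/
def grayRunCount {c : ℕ} {N : Fin c → ℕ} (T : Finset (Row N)) : ℕ :=
  ∑ j, runs ((T.sort GrayLE).map fun t => t j)

/-- Reordering of the columns of a table: column `σ j` of `T` is put in position `j`. -/
def permuteColumns {c : ℕ} {N : Fin c → ℕ} (σ : Equiv.Perm (Fin c)) (T : Finset (Row N)) :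
    Finset (Row (fun j => N (σ j))) :=
  T.image fun t j => t (σ j)

open Classical in
/-- The expected number of column runs of a uniformly distributed table, whose columns are put in
the order `σ 0, σ 1, …, σ (c - 1)` and whose rows are then sorted in reflected Gray-code order.
In a uniformly distributed table, each possible row is present with probability `p`,
independently of the others. -/
noncomputable def expectedRuns {c : ℕ} (N : Fin c → ℕ) (p : unitInterval)
    (σ : Equiv.Perm (Fin c)) : ℝ :=
  ∫ T : Set (Row N), (grayRunCount (permuteColumns σ T.toFinset) : ℝ)
    ∂(ProbabilityTheory.setBernoulli Set.univ p)

end GrayRuns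

/-!
Write `q = 1 - p`. In Gray-code order the entries of a column of cardinality `M` that is followed by
`B` and preceded by `n` combinations of values are `wave M (a / B)`, `a < n * M * B`, where `wave M`
runs up and down through `0, …, M - 1` (`grayRow`, `sort_grayLE`). A run starts at the first present
row and at each present row whose predecessor among the present rows has a different entry, so that
the expected number of runs is `1 - q ^ (n * M * B)` plus the sum of `p² q ^ (d - 1)` over the pairs
of positions at distance `d` with unequal entries (`integral_runs`). Continuing the wave beyond the
last row adds only pairs across the end of the table; among these at most one pair of present rows
is consecutive, so that the ideal cost `n * columnCost q M B` obtained in this way is at most the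
expected number of runs and at least that number minus one (`column_bounds`). This is the source of
the additive term `c`: it remains to show that the increasing order minimizes the total ideal cost.

The total ideal cost satisfies a recursion along the list of cardinalities (`tableCost`), so an
exchange of two neighbours `M ≤ K` suffices (`columnCost_exchange`, `tableCost_le_of_perm`). With
`y = q ^ P`, where `P` counts the combinations of values of the columns that follow, the difference
of the two costs is `(1 - y)² ∑ F(d) y ^ (d - 1)`, where `F = exchangeDefect M K` is an explicit
even function with period `2 M K`, composed of tents, triangle waves and combs. Although `F` changes
sign, it is the second difference of an explicit cubic spline `V = exchangeSpline M K` with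
`V(0) = V(1) = 0`, which makes the difference equal to `(1 - y)⁴ ∑ V(d + 1) y ^ (d - 1)`. The spline
is nonnegative (`exchangeSpline_nonneg`): it is a parabola on a half period, apart from bounded
oscillations and from a short initial stretch. The argument works for all cardinalities that are at
least `2`.
-/

namespace GrayRuns

/-! ### The reflected distance to the multiples of an even modulus -/

/-- The distance from `n` to the nearest multiple of `2 * m`. -/
def evenDist (m n : ℕ) : ℕ := min (n % (2 * m)) (2 * m - n % (2 * m))

lemma evenDist_le (m n : ℕ) : evenDist m n ≤ m := by unfold evenDist; omega

lemma evenDist_of_le {m n : ℕ} (h : n ≤ m) : evenDist m n = n := by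
  rcases Nat.eq_zero_or_pos m with rfl | hm
  · simp_all [evenDist]
  · rw [evenDist, Nat.mod_eq_of_lt (by omega)]; omega

lemma evenDist_of_le_two_mul {m n : ℕ} (h : m ≤ n) (h' : n ≤ 2 * m) :
    evenDist m n = 2 * m - n := by
  rcases h'.eq_or_lt with rfl | h'
  · simp [evenDist]
  · rw [evenDist, Nat.mod_eq_of_lt h']; omega

/-- The distance to the multiples of `2 * m` only depends on the distance to the multiples of a
multiple of `2 * m`. -/
lemma evenDist_evenDist {m k : ℕ} (h : m ∣ k) (hk : 0 < k) (n : ℕ) :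
    evenDist m (evenDist k n) = evenDist m n := by
  obtain ⟨l, rfl⟩ := h
  have hn : n % (2 * m) = n % (2 * (m * l)) % (2 * m) :=
    (Nat.mod_mod_of_dvd n ⟨l, by ring⟩).symm
  have hle : n % (2 * (m * l)) < 2 * (m * l) := Nat.mod_lt _ (by omega)
  have hm : 0 < m := Nat.pos_of_mul_pos_right hk
  rcases le_total (n % (2 * (m * l))) (2 * (m * l) - n % (2 * (m * l))) with h | h
  · simp only [evenDist, min_eq_left h, hn]
  · rw [evenDist, evenDist, evenDist, min_eq_right h, hn]
    generalize n % (2 * (m * l)) = r at *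
    have h1 := Nat.div_add_mod r (2 * m)
    have h2 := Nat.mod_lt r (show 0 < 2 * m by omega)
    generalize r % (2 * m) = s at *
    generalize r / (2 * m) = q at *
    subst h1
    rcases Nat.eq_zero_or_pos s with rfl | hs
    · have : 2 * (m * l) - (2 * m * q + 0) = 2 * m * (l - q) := by
        rw [Nat.mul_sub]; ring_nf
      rw [this]; simp
    · have hql : q < l := by
        have : 2 * m * q < 2 * m * l := by nlinarith
        exact lt_of_mul_lt_mul_left this (by omega)
      obtain ⟨t, rfl⟩ : ∃ t, l = q + 1 + t := ⟨l - (q + 1), by omega⟩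
      have : 2 * (m * (q + 1 + t)) - (2 * m * q + s) = (2 * m - s) + 2 * m * t := by
        have : 2 * (m * (q + 1 + t)) = 2 * m * q + 2 * m + 2 * m * t := by ring
        omega
      rw [this, Nat.add_mul_mod_self_left, Nat.mod_eq_of_lt (by omega)]
      omega

/-- The second difference of a function of the distance to the multiples of `2 * m`. -/
lemma evenDist_second_difference {m : ℕ} (hm : 0 < m) (p q : ℕ → ℝ)
    (h0 : 2 * (p 1 - p 0) = q 0)
    (hmid : ∀ r, r + 1 < m → p (r + 2) - 2 * p (r + 1) + p r = q (r + 1))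
    (htop : 2 * (p (m - 1) - p m) = q m) (n : ℕ) :
    p (evenDist m (n + 2)) - 2 * p (evenDist m (n + 1)) + p (evenDist m n)
      = q (evenDist m (n + 1)) := by
  have hr : (n + 1) % (2 * m) < 2 * m := Nat.mod_lt _ (by omega)
  have e2 : (n + 2) % (2 * m) =
      if (n + 1) % (2 * m) + 1 = 2 * m then 0 else (n + 1) % (2 * m) + 1 := by
    rw [show n + 2 = n + 1 + 1 from rfl, Nat.add_mod (n + 1) 1]
    rw [Nat.mod_eq_of_lt (show 1 < 2 * m by omega)]
    split_ifs with h
    · rw [h, Nat.mod_self]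
    · exact Nat.mod_eq_of_lt (by omega)
  have e1 : (n + 1) % (2 * m) = if n % (2 * m) + 1 = 2 * m then 0 else n % (2 * m) + 1 := by
    have := Nat.mod_lt n (show 0 < 2 * m by omega)
    rw [Nat.add_mod n 1]
    rw [Nat.mod_eq_of_lt (show 1 < 2 * m by omega)]
    split_ifs with h
    · rw [h, Nat.mod_self]
    · exact Nat.mod_eq_of_lt (by omega)
  have e0 := Nat.mod_lt n (show 0 < 2 * m by omega)
  unfold evenDist
  rw [e2]
  generalize (n + 1) % (2 * m) = r at *
  generalize n % (2 * m) = s at *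
  by_cases hr0 : r = 0
  · have hs : s = 2 * m - 1 := by split_ifs at e1 <;> omega
    subst hr0 hs
    have a1 : min (2 * m - 1) (2 * m - (2 * m - 1)) = 1 := by omega
    have a2 : min (0 : ℕ) (2 * m - 0) = 0 := by omega
    rw [if_neg (by omega), a1, a2, ← h0]
    have a3 : min (0 + 1) (2 * m - (0 + 1)) = 1 := by omega
    rw [a3]; ring
  · have hs : s = r - 1 := by split_ifs at e1 <;> omega
    subst hs
    rcases lt_trichotomy r m with h | h | h
    · obtain ⟨t, rfl⟩ : ∃ t, r = t + 1 := ⟨r - 1, by omega⟩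
      rw [if_neg (by omega), show min (t + 1 + 1) (2 * m - (t + 1 + 1)) = t + 2 by omega,
        show min (t + 1) (2 * m - (t + 1)) = t + 1 by omega,
        show min (t + 1 - 1) (2 * m - (t + 1 - 1)) = t by omega]
      exact hmid t h
    · subst h
      rw [show min r (2 * r - r) = r by omega,
        show min (r - 1) (2 * r - (r - 1)) = r - 1 by omega, ← htop]
      split_ifs with h
      · rw [show min 0 (2 * r - 0) = r - 1 by omega]; ring
      · rw [show min (r + 1) (2 * r - (r + 1)) = r - 1 by omega]; ring
    · obtain ⟨t, ht⟩ : ∃ t, 2 * m - r = t + 1 := ⟨2 * m - r - 1, by omega⟩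
      rw [show min r (2 * m - r) = t + 1 by omega,
        show min (r - 1) (2 * m - (r - 1)) = t + 2 by omega, ← hmid t (by omega)]
      split_ifs with h
      · rw [show min 0 (2 * m - 0) = t by omega]; ring
      · rw [show min (r + 1) (2 * m - (r + 1)) = t by omega]; ring

/-! ### The cubic splines behind the exchange of two columns -/

/-- The cubic whose composition with the triangle wave `evenDist K`, or `evenDist M`, enters
`exchangeSpline`. For both waves its second difference is the wave itself, up to a constant and
to a point mass `M * K` at the zeros of the wave. -/
noncomputable def sawCubic (M K s : ℝ) : ℝ :=
  M * K * s / 2 - (K + M) * s ^ 2 / 4 + (s ^ 3 - s) / 6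

/-- The double sum of the tent function `r ↦ max (m - r) 0`, in which the peak at `r = 0` has
half weight: the even solution, zero at `0`, with the tent function as second difference. -/
noncomputable def tentSum (m r : ℝ) : ℝ :=
  if r ≤ m then m * r ^ 2 / 2 - (r ^ 3 - r) / 6 else m ^ 2 * r / 2 - (m ^ 3 - m) / 6

/-- The part of `exchangeSpline` that depends on the distance to the multiples of the
period `2 * (M * K)`. -/
noncomputable def tentSpline (M K r : ℝ) : ℝ :=
  M * tentSum K r - K * tentSum M r - (K - M) * r ^ 2 / 4

/-- The even function with period `2 * (M * K)`, zero at `0`, whose second differences are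
`exchangeDefect M K`. -/
noncomputable def exchangeSpline (M K n : ℕ) : ℝ :=
  tentSpline M K (evenDist (M * K) n) + sawCubic M K (evenDist K n) - sawCubic M K (evenDist M n)
    + (K - M) / 4 * evenDist 1 n

/-- The number of unequal pairs of entries at distance `n` in two columns of cardinalities
`K, M`, in this order, minus the number for the order `M, K`. The pairs start in one pass
through the `M * K` combinations of values; `exchangeDefect_eq` is the count. -/
noncomputable def exchangeDefect (M K n : ℕ) : ℝ :=
  evenDist K n - evenDist M n
    + (M * max ((K : ℝ) - evenDist (M * K) n) 0 - K * max ((M : ℝ) - evenDist (M * K) n) 0)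
    - (K - M) * evenDist 1 n
    + M * K * ((if 2 * K ∣ n then 1 else 0) - (if 2 * M ∣ n then 1 else 0))

lemma evenDist_eq_zero_iff {m : ℕ} (hm : 0 < m) (n : ℕ) : evenDist m n = 0 ↔ 2 * m ∣ n := by
  rw [Nat.dvd_iff_mod_eq_zero, evenDist]
  have := Nat.mod_lt n (show 0 < 2 * m by omega)
  omega

lemma exchangeSpline_second_difference {M K : ℕ} (hM : 2 ≤ M) (hMK : M ≤ K) (n : ℕ) :
    exchangeSpline M K (n + 2) - 2 * exchangeSpline M K (n + 1) + exchangeSpline M K n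
      = exchangeDefect M K (n + 1) := by
  have hM0 : 0 < M := by omega
  have hK0 : 0 < K := by omega
  have hM1 : (2 : ℝ) ≤ M := by exact_mod_cast hM
  have hMK1 : (M : ℝ) ≤ K := by exact_mod_cast hMK
  have hMK2 : K + 1 ≤ M * K := by nlinarith
  have hMK3 : (K : ℝ) + 1 ≤ M * K := by exact_mod_cast hMK2
  have hsaw : ∀ m : ℕ, 0 < m → (m = M ∨ m = K) →
      sawCubic M K (evenDist m (n + 2)) - 2 * sawCubic M K (evenDist m (n + 1))
        + sawCubic M K (evenDist m n)
      = M * K * (if 2 * m ∣ n + 1 then 1 else 0) + evenDist m (n + 1) - (K + M) / 2 := by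
    intro m hm hm'
    have := evenDist_second_difference hm (fun r => sawCubic M K r)
      (fun r => M * K * (if r = 0 then 1 else 0) + r - (K + M) / 2) ?_ ?_ ?_ n
    · simpa only [evenDist_eq_zero_iff hm] using this
    · simp only [sawCubic]; push_cast; simp; ring
    · intro r _; simp only [sawCubic]; push_cast; simp; ring
    · obtain ⟨t, rfl⟩ : ∃ t, m = t + 1 := ⟨m - 1, by omega⟩
      have : (t : ℝ) = M - 1 ∨ (t : ℝ) = K - 1 := by
        rcases hm' with h | h
        · left; rw [← h]; push_cast; ring
        · right; rw [← h]; push_cast; ring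
      simp only [sawCubic]; push_cast
      simp
      rcases this with h | h <;> rw [h] <;> ring
  have hodd := evenDist_second_difference one_pos (fun r => ((K : ℝ) - M) / 4 * r)
      (fun r => (K - M) / 2 - (K - M) * r) (by simp; ring) (by intro r hr; omega) (by simp; ring) n
  have htent := evenDist_second_difference (show 0 < M * K by positivity)
    (fun r => tentSpline M K r)
    (fun r => M * max ((K : ℝ) - r) 0 - K * max ((M : ℝ) - r) 0 - (K - M) / 2) ?_ ?_ ?_ n
  · have h1 := hsaw M hM0 (Or.inl rfl)
    have h2 := hsaw K hK0 (Or.inr rfl)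
    simp only [exchangeSpline, exchangeDefect]
    linear_combination htent + hodd + h2 - h1
  · simp only [tentSpline, tentSum]
    push_cast
    rw [if_pos (by linarith), if_pos (by linarith), if_pos (by linarith), if_pos (by linarith),
      max_eq_left (by linarith), max_eq_left (by linarith)]
    ring
  · intro r _
    have h : ∀ m : ℕ, tentSum m (r + 2 : ℕ) - 2 * tentSum m (r + 1 : ℕ) + tentSum m r
        = max ((m : ℝ) - (r + 1 : ℕ)) 0 := by
      intro m
      simp only [tentSum, Nat.cast_le]
      rcases lt_trichotomy m (r + 1) with h | h | h
      · rw [if_neg (by omega), if_neg (by omega), max_eq_right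
          (sub_nonpos.2 (by exact_mod_cast h.le))]
        split_ifs with h'
        · obtain rfl : m = r := by omega
          push_cast; ring
        · push_cast; ring
      · subst h
        rw [if_neg (by omega), if_pos (by omega), if_pos (by omega)]
        push_cast; simp; ring
      · rw [if_pos (by omega), if_pos (by omega), if_pos (by omega), max_eq_left
          (sub_nonneg.2 (by exact_mod_cast h.le))]
        push_cast; ring
    simp only [tentSpline]
    rw [← h, ← h]
    push_cast; ring
  · obtain ⟨t, ht⟩ : ∃ t, M * K = t + 1 := ⟨M * K - 1, by omega⟩
    have ht' : (t : ℝ) = M * K - 1 := by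
      have : (M : ℝ) * K = t + 1 := by exact_mod_cast ht
      linarith
    rw [ht]
    simp only [tentSpline, tentSum, Nat.add_sub_cancel]
    push_cast
    rw [ht']
    have aux : ∀ m : ℝ, m ≤ K → (if (M * K - 1 : ℝ) ≤ m then
        m * (M * K - 1 : ℝ) ^ 2 / 2 - ((M * K - 1 : ℝ) ^ 3 - (M * K - 1)) / 6
        else m ^ 2 * (M * K - 1) / 2 - (m ^ 3 - m) / 6)
        = m ^ 2 * (M * K - 1) / 2 - (m ^ 3 - m) / 6 := by
      intro m hm
      split_ifs with h
      · obtain rfl : m = M * K - 1 := le_antisymm (by linarith) h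
        ring
      · rfl
    rw [aux _ le_rfl, aux _ hMK1, if_neg (by linarith), if_neg (by linarith),
      max_eq_right (by linarith), max_eq_right (by linarith)]
    ring

lemma exchangeSpline_zero (M K : ℕ) : exchangeSpline M K 0 = 0 := by
  simp [exchangeSpline, evenDist, tentSpline, tentSum, sawCubic]

lemma exchangeSpline_one {M K : ℕ} (hM : 2 ≤ M) (hMK : M ≤ K) : exchangeSpline M K 1 = 0 := by
  have h : 1 ≤ M * K := by nlinarith
  have hM1 : (2 : ℝ) ≤ M := by exact_mod_cast hM
  have hMK1 : (M : ℝ) ≤ K := by exact_mod_cast hMK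
  simp only [exchangeSpline, evenDist_of_le h, evenDist_of_le (show 1 ≤ M by omega),
    evenDist_of_le (show 1 ≤ K by omega), evenDist_of_le le_rfl, tentSpline, tentSum]
  push_cast
  rw [if_pos (by linarith), if_pos (by linarith)]
  ring

/-! ### Nonnegativity of the exchange spline -/

lemma sawCubic_le {M K s : ℝ} (hMK : M ≤ K) (hs0 : 0 ≤ s) (hs : s ≤ M) :
    sawCubic M K s ≤ M ^ 2 * K / 4 - M ^ 3 / 12 := by
  unfold sawCubic
  nlinarith [mul_nonneg (mul_nonneg (sub_nonneg.2 hs) (sub_nonneg.2 hs)) (sub_nonneg.2 hMK),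
    mul_nonneg (mul_nonneg (sub_nonneg.2 hs) (sub_nonneg.2 hs)) (sub_nonneg.2 hs)]

lemma sawCubic_nonneg {M K s : ℝ} (hM : 2 ≤ M) (hMK : M ≤ K) (hs0 : 0 ≤ s) (hs : s ≤ M) :
    0 ≤ sawCubic M K s := by
  unfold sawCubic
  obtain ⟨u, rfl⟩ : ∃ u, M = s + u := ⟨M - s, by ring⟩
  obtain ⟨v, rfl⟩ : ∃ v, K = s + u + v := ⟨K - (s + u), by ring⟩
  have : 0 ≤ u := by linarith
  have : 0 ≤ v := by linarith
  have : 0 ≤ s * v * s := by positivity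
  have : 0 ≤ s * v * u := by positivity
  have : 0 ≤ s * u * s := by positivity
  have : 0 ≤ s * (u * u) := by positivity
  nlinarith [mul_nonneg hs0 (by nlinarith : 0 ≤ (s + u) * (s + u) - 4)]

lemma sawCubic_ge {M K s : ℝ} (hM : 0 ≤ M) (hs0 : M ≤ s) (hs : s ≤ K) :
    sawCubic M K K ≤ sawCubic M K s := by
  unfold sawCubic
  obtain ⟨u, rfl⟩ : ∃ u, s = M + u := ⟨s - M, by ring⟩
  obtain ⟨v, rfl⟩ : ∃ v, K = M + u + v := ⟨K - (M + u), by ring⟩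
  have : 0 ≤ u := by linarith
  have : 0 ≤ v := by linarith
  have : 0 ≤ v * v * u := by positivity
  have : 0 ≤ v * v * v := by positivity
  have : 0 ≤ M * v * u := by positivity
  have : 0 ≤ M * (v * v) := by positivity
  nlinarith

/-- The exchange spline at `M < R ≤ min K (2 * M)`, without its odd part. As in the lemmas that
follow, the expression becomes a polynomial with nonnegative coefficients in the gaps between the
parameters. -/
lemma exchange_cubic_nonneg_of_le_two_mul {M K R : ℝ}
    (hR : M + 1 ≤ R) (hR' : R ≤ 2 * M) (hK : R ≤ K) :
    0 ≤ M * (K * R ^ 2 / 2 - (R ^ 3 - R) / 6) - K * (M ^ 2 * R / 2 - (M ^ 3 - M) / 6)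
      - (K - M) * R ^ 2 / 4
      + sawCubic M K R - sawCubic M K (2 * M - R) := by
  obtain ⟨v, rfl⟩ : ∃ v, K = R + v := ⟨K - R, by ring⟩
  obtain ⟨u, rfl⟩ : ∃ u, R = M + 1 + u := ⟨R - M - 1, by ring⟩
  obtain ⟨m, rfl⟩ : ∃ m, M = m + u + 1 := ⟨M - u - 1, by ring⟩
  have : 0 ≤ m := by linarith
  have : 0 ≤ u := by linarith
  have : 0 ≤ v := by linarith
  have : 0 ≤ 2 * m ^ 3 * u + 2 * m ^ 3 * v + 2 * m ^ 3 + 12 * m ^ 2 * u ^ 2 + 12 * m ^ 2 * u * v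
      + 21 * m ^ 2 * u + 9 * m ^ 2 * v + 9 * m ^ 2 + 22 * m * u ^ 3 + 24 * m * u ^ 2 * v
      + 54 * m * u ^ 2 + 36 * m * u * v + 42 * m * u + 10 * m * v + 10 * m + 12 * u ^ 4
      + 14 * u ^ 3 * v + 40 * u ^ 3 + 30 * u ^ 2 * v + 48 * u ^ 2 + 16 * u * v + 20 * u := by
    positivity
  unfold sawCubic
  linarith

/-- A lower bound for the exchange spline at `2 * M ≤ R ≤ K`. -/
lemma exchange_cubic_nonneg_of_two_mul_le {M K R : ℝ}
    (hM : 2 ≤ M) (hR : 2 * M ≤ R) (hK : R ≤ K) :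
    0 ≤ M * (K * R ^ 2 / 2 - (R ^ 3 - R) / 6) - K * (M ^ 2 * R / 2 - (M ^ 3 - M) / 6)
      - (K - M) * R ^ 2 / 4
      + sawCubic M K R - (M ^ 2 * K / 4 - M ^ 3 / 12) := by
  obtain ⟨v, rfl⟩ : ∃ v, K = R + v := ⟨K - R, by ring⟩
  obtain ⟨u, rfl⟩ : ∃ u, R = 2 * M + u := ⟨R - 2 * M, by ring⟩
  obtain ⟨m, rfl⟩ : ∃ m, M = m + 2 := ⟨M - 2, by ring⟩
  have : 0 ≤ m := by linarith
  have : 0 ≤ u := by linarith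
  have : 0 ≤ v := by linarith
  have : 0 ≤ 12 * m ^ 4 + 26 * m ^ 3 * u + 14 * m ^ 3 * v + 83 * m ^ 3 + 18 * m ^ 2 * u ^ 2
      + 18 * m ^ 2 * u * v + 129 * m ^ 2 * u + 69 * m ^ 2 * v + 210 * m ^ 2 + 4 * m * u ^ 3
      + 6 * m * u ^ 2 * v + 54 * m * u ^ 2 + 54 * m * u * v + 204 * m * u + 106 * m * v
      + 224 * m + 4 * u ^ 3 + 6 * u ^ 2 * v + 36 * u ^ 2 + 36 * u * v + 98 * u + 48 * v + 80 := by
    positivity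
  unfold sawCubic
  linarith

/-- The exchange spline at `K ≤ R ≤ 2 * M`, without its odd part. -/
lemma exchange_quadratic_nonneg_of_le_two_mul {M K R : ℝ}
    (hK : M + 1 ≤ K) (hR : K ≤ R) (hR' : R ≤ 2 * M) :
    0 ≤ (K - M) * R * (2 * M * K - R) / 4 - M * K * (K ^ 2 - M ^ 2) / 6
      + sawCubic M K (2 * K - R) - sawCubic M K (2 * M - R) := by
  obtain ⟨u, rfl⟩ : ∃ u, R = K + u := ⟨R - K, by ring⟩
  obtain ⟨v, rfl⟩ : ∃ v, K = M + 1 + v := ⟨K - M - 1, by ring⟩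
  obtain ⟨m, rfl⟩ : ∃ m, M = m + 1 + v + u := ⟨M - 1 - v - u, by ring⟩
  have : 0 ≤ m := by linarith
  have : 0 ≤ u := by linarith
  have : 0 ≤ v := by linarith
  have : 0 ≤ 2 * m ^ 3 * v + 2 * m ^ 3 + 12 * m ^ 2 * u * v + 12 * m ^ 2 * u + 12 * m ^ 2 * v ^ 2
      + 21 * m ^ 2 * v + 9 * m ^ 2 + 18 * m * u ^ 2 * v + 18 * m * u ^ 2
      + 42 * m * u * v ^ 2 + 72 * m * u * v + 30 * m * u + 22 * m * v ^ 3 + 54 * m * v ^ 2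
      + 42 * m * v + 10 * m + 8 * u ^ 3 * v + 8 * u ^ 3 + 30 * u ^ 2 * v ^ 2
      + 60 * u ^ 2 * v + 30 * u ^ 2 + 34 * u * v ^ 3 + 90 * u * v ^ 2 + 78 * u * v + 22 * u
      + 12 * v ^ 4 + 40 * v ^ 3 + 48 * v ^ 2 + 20 * v := by
    positivity
  unfold sawCubic
  linarith

/-- A lower bound for the exchange spline beyond `K ≥ 2 * M`, where `sawCubic M K` is nonnegative
at the distance to the multiples of `2 * K`. -/
lemma parabola_nonneg_of_two_mul_le {M K : ℝ} (hM : 2 ≤ M) (hK : 2 * M ≤ K) :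
    0 ≤ (K - M) * K * (2 * M * K - K) / 4 - M * K * (K ^ 2 - M ^ 2) / 6
      - (M ^ 2 * K / 4 - M ^ 3 / 12) := by
  obtain ⟨v, rfl⟩ : ∃ v, K = 2 * M + v := ⟨K - 2 * M, by ring⟩
  obtain ⟨m, rfl⟩ : ∃ m, M = m + 2 := ⟨M - 2, by ring⟩
  have : 0 ≤ m := by linarith
  have : 0 ≤ v := by linarith
  have : 0 ≤ 12 * m ^ 4 + 26 * m ^ 3 * v + 79 * m ^ 3 + 18 * m ^ 2 * v ^ 2 + 129 * m ^ 2 * v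
      + 186 * m ^ 2 + 4 * m * v ^ 3 + 57 * m * v ^ 2 + 204 * m * v + 180 * m + 5 * v ^ 3
      + 42 * v ^ 2 + 100 * v + 56 := by
    positivity
  linarith

/-- A lower bound for the exchange spline beyond `K ≥ 2 * M`, where `sawCubic M K` may be as small
as `sawCubic M K K`. -/
lemma parabola_add_sawCubic_nonneg_of_two_mul_le {M K : ℝ} (hM : 2 ≤ M) (hK : 2 * M ≤ K) :
    0 ≤ (K - M) * K * (2 * M * K - K) / 4 - M * K * (K ^ 2 - M ^ 2) / 6
      + sawCubic M K K - (M ^ 2 * K / 4 - M ^ 3 / 12) := by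
  obtain ⟨v, rfl⟩ : ∃ v, K = 2 * M + v := ⟨K - 2 * M, by ring⟩
  obtain ⟨m, rfl⟩ : ∃ m, M = m + 2 := ⟨M - 2, by ring⟩
  have : 0 ≤ m := by linarith
  have : 0 ≤ v := by linarith
  have : 0 ≤ 12 * m ^ 4 + 26 * m ^ 3 * v + 83 * m ^ 3 + 18 * m ^ 2 * v ^ 2 + 129 * m ^ 2 * v
      + 210 * m ^ 2 + 4 * m * v ^ 3 + 54 * m * v ^ 2 + 204 * m * v + 224 * m + 4 * v ^ 3
      + 36 * v ^ 2 + 98 * v + 80 := by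
    positivity
  unfold sawCubic
  linarith
/-- A lower bound for the exchange spline beyond `2 * M ≥ K`. -/
lemma parabola_nonneg_of_le_two_mul {M K : ℝ} (hM : 2 ≤ M) (hK : M + 1 ≤ K) (hK' : K ≤ 2 * M) :
    0 ≤ (K - M) * (2 * M) * (2 * M * K - 2 * M) / 4 - M * K * (K ^ 2 - M ^ 2) / 6
      - (M ^ 2 * K / 4 - M ^ 3 / 12) := by
  obtain ⟨v, rfl⟩ : ∃ v, K = M + 1 + v := ⟨K - M - 1, by ring⟩
  obtain ⟨m, rfl⟩ : ∃ m, M = m + 2 := ⟨M - 2, by ring⟩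
  have hm : 0 ≤ m := by linarith
  have hv : 0 ≤ v := by linarith
  have hvm : 0 ≤ (m + 1 - v) * (2 * m * v ^ 2 + 4 * v ^ 2) :=
    mul_nonneg (by linarith) (by positivity)
  have : 0 ≤ 8 * m ^ 3 * v + 6 * m ^ 3 + 4 * m ^ 2 * v ^ 2 + 45 * m ^ 2 * v + 27 * m ^ 2
      + 12 * m * v ^ 2 + 78 * m * v + 34 * m + 8 * v ^ 2 + 40 * v + 8 := by
    positivity
  linarith

/-- Beyond the tents of half-width `M` and `K`, `tentSpline` is a parabola that increases up to
half a period. -/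
lemma tentSpline_of_le {M K R : ℝ} (hMK : M ≤ K) (hK : K ≤ R) :
    tentSpline M K R = (K - M) * R * (2 * M * K - R) / 4 - M * K * (K ^ 2 - M ^ 2) / 6 := by
  have aux : ∀ m : ℝ, m ≤ K → tentSum m R = m ^ 2 * R / 2 - (m ^ 3 - m) / 6 := by
    intro m hm
    rw [tentSum]
    split_ifs with h
    · obtain rfl : m = R := by linarith
      ring
    · rfl
  rw [tentSpline, aux _ le_rfl, aux _ hMK]
  ring

/-- The exchange spline is nonnegative on half a period, and hence everywhere. -/
theorem exchangeSpline_nonneg {M K : ℕ} (hM : 2 ≤ M) (hMK : M ≤ K) (n : ℕ) :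
    0 ≤ exchangeSpline M K n := by
  rcases hMK.eq_or_lt with rfl | hlt
  · simp [exchangeSpline, tentSpline]
  have hpos : 0 < M * K := Nat.mul_pos (by omega) (by omega)
  have hM1 : (2 : ℝ) ≤ M := by exact_mod_cast hM
  have hMK1 : (M : ℝ) + 1 ≤ K := by exact_mod_cast hlt
  obtain ⟨R, hR⟩ : ∃ R, evenDist (M * K) n = R := ⟨_, rfl⟩
  have hRle : R ≤ M * K := hR ▸ evenDist_le _ _
  have hRle' : (R : ℝ) ≤ M * K := by exact_mod_cast hRle
  rw [exchangeSpline, ← evenDist_evenDist (Dvd.intro_left M rfl) hpos n,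
    ← evenDist_evenDist (Dvd.intro K rfl) hpos n, ← evenDist_evenDist (one_dvd _) hpos n, hR]
  have hodd : (0 : ℝ) ≤ (K - M) / 4 * evenDist 1 R :=
    mul_nonneg (by linarith) (Nat.cast_nonneg _)
  have hsM : sawCubic M K (evenDist M R) ≤ M ^ 2 * K / 4 - M ^ 3 / 12 :=
    sawCubic_le (by linarith) (Nat.cast_nonneg _) (by exact_mod_cast evenDist_le M R)
  rcases le_or_gt R M with hRM | hRM
  · have hRM1 : (R : ℝ) ≤ M := by exact_mod_cast hRM
    rw [evenDist_of_le hRM, evenDist_of_le (hRM.trans hMK), tentSpline, tentSum, tentSum,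
      if_pos (by linarith), if_pos hRM1]
    have : (0 : ℝ) ≤ (K - M) * ((R ^ 3 - R) / 6 - R ^ 2 / 4 + (evenDist 1 R : ℝ) / 4) := by
      apply mul_nonneg (by linarith)
      rcases lt_or_ge R 2 with h2 | h2
      · interval_cases R <;> norm_num [evenDist]
      · have h3 : (2 : ℝ) ≤ R := by exact_mod_cast h2
        have h4 : (0 : ℝ) ≤ evenDist 1 R := Nat.cast_nonneg _
        nlinarith [mul_nonneg (by linarith : (0 : ℝ) ≤ R)
          (by nlinarith : (0 : ℝ) ≤ 2 * (R : ℝ) ^ 2 - 3 * R - 2)]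
    linarith
  have hRM1 : (M : ℝ) + 1 ≤ R := by exact_mod_cast hRM
  rcases le_or_gt R K with hRK | hRK
  · have hRK1 : (R : ℝ) ≤ K := by exact_mod_cast hRK
    rw [evenDist_of_le hRK, tentSpline, tentSum, tentSum, if_pos hRK1, if_neg (by linarith)]
    rcases le_or_gt R (2 * M) with h2 | h2
    · have h3 : (R : ℝ) ≤ 2 * M := by exact_mod_cast h2
      rw [evenDist_of_le_two_mul hRM.le h2, Nat.cast_sub h2]
      push_cast
      linarith [exchange_cubic_nonneg_of_le_two_mul hRM1 h3 hRK1]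
    · have h3 : 2 * (M : ℝ) ≤ R := by exact_mod_cast h2.le
      linarith [exchange_cubic_nonneg_of_two_mul_le hM1 h3 hRK1]
  have hRK1 : (K : ℝ) ≤ R := by exact_mod_cast hRK.le
  rw [tentSpline_of_le (by linarith) hRK1]
  -- the parabola `x ↦ (K - M) x (2 M K - x) / 4` increases on `[0, M K]`
  have hpar : ∀ x : ℝ, x ≤ R →
      (K - M) * x * (2 * M * K - x) / 4 ≤ ((K : ℝ) - M) * R * (2 * M * K - R) / 4 := by
    intro x hx
    have := mul_nonneg (sub_nonneg.2 (by linarith : (M : ℝ) ≤ K))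
      (mul_nonneg (sub_nonneg.2 hx) (by linarith : (0 : ℝ) ≤ 2 * M * K - R - x))
    linarith
  rcases le_or_gt R (2 * M) with h2 | h2
  · have h3 : (R : ℝ) ≤ 2 * M := by exact_mod_cast h2
    have h2' : R ≤ 2 * K := by omega
    rw [evenDist_of_le_two_mul hRM.le h2, evenDist_of_le_two_mul hRK.le h2', Nat.cast_sub h2,
      Nat.cast_sub h2']
    push_cast
    linarith [exchange_quadratic_nonneg_of_le_two_mul hMK1 hRK1 h3]
  have h3 : 2 * (M : ℝ) ≤ R := by exact_mod_cast h2.le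
  rcases le_total (2 * (M : ℝ)) K with h4 | h4
  · have h5 := hpar K hRK1
    rcases le_total (evenDist K R) M with h6 | h6
    · have := sawCubic_nonneg hM1 (by linarith : (M : ℝ) ≤ K) (Nat.cast_nonneg _)
        (by exact_mod_cast h6 : (evenDist K R : ℝ) ≤ M)
      linarith [parabola_nonneg_of_two_mul_le hM1 h4]
    · have := sawCubic_ge (by linarith) (by exact_mod_cast h6 : (M : ℝ) ≤ evenDist K R)
        (by exact_mod_cast evenDist_le K R : (evenDist K R : ℝ) ≤ K)
      linarith [parabola_add_sawCubic_nonneg_of_two_mul_le hM1 h4]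
  · have h5 := hpar (2 * M) h3
    have h6 : 0 ≤ sawCubic M K (evenDist K R) := by
      rcases le_total (evenDist K R) M with h6 | h6
      · exact sawCubic_nonneg hM1 (by linarith : (M : ℝ) ≤ K) (Nat.cast_nonneg _)
          (by exact_mod_cast h6 : (evenDist K R : ℝ) ≤ M)
      · refine le_trans ?_ (sawCubic_ge (by linarith) (by exact_mod_cast h6)
          (by exact_mod_cast evenDist_le K R : (evenDist K R : ℝ) ≤ K))
        have : (0 : ℝ) ≤ K * (K * (2 * M - K) + (K * M - 2)) :=
          mul_nonneg (by linarith) (add_nonneg (mul_nonneg (by linarith) (by linarith))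
            (by nlinarith))
        unfold sawCubic
        linarith
    linarith [parabola_nonneg_of_le_two_mul hM1 hMK1 h4]

/-! ### Abel sums of bounded sequences and blockwise linear interpolation -/

/-- `(1 - q)²` times the generating function of a sequence at positive distances: the
rate of transitions when two present rows at distance `d` contribute `ψ d`. -/
noncomputable def abelSum (q : ℝ) (ψ : ℕ → ℝ) : ℝ := (1 - q) ^ 2 * ∑' d, q ^ d * ψ (d + 1)

/-- The piecewise linear interpolation, at step `B`, of a sequence. -/
noncomputable def interp (B : ℕ) (ψ : ℕ → ℝ) (n : ℕ) : ℝ :=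
  ψ (n / B) * B + (ψ (n / B + 1) - ψ (n / B)) * (n % B : ℕ)

lemma summable_pow_mul_of_bounded {q : ℝ} (h0 : 0 ≤ q) (h1 : q < 1) {ψ : ℕ → ℝ} {C : ℝ}
    (hψ : ∀ n, |ψ n| ≤ C) : Summable fun n => q ^ n * ψ n := by
  refine Summable.of_norm_bounded (g := fun n => q ^ n * C)
    ((summable_geometric_of_lt_one h0 h1).mul_right C) fun n => ?_
  rw [Real.norm_eq_abs, abs_mul, abs_of_nonneg (pow_nonneg h0 n)]
  exact mul_le_mul_of_nonneg_left (hψ n) (pow_nonneg h0 n)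

/-- Summation by parts. -/
lemma one_sub_mul_tsum_succ {q : ℝ} (h0 : 0 ≤ q) (h1 : q < 1) {ψ : ℕ → ℝ} {C : ℝ}
    (hψ : ∀ n, |ψ n| ≤ C) (hz : ψ 0 = 0) :
    (1 - q) * ∑' n, q ^ n * ψ (n + 1) = ∑' n, q ^ n * (ψ (n + 1) - ψ n) := by
  have hs := summable_pow_mul_of_bounded h0 h1 hψ
  have hs' := summable_pow_mul_of_bounded h0 h1 (ψ := fun n => ψ (n + 1)) fun n => hψ (n + 1)
  have h := hs.tsum_eq_zero_add
  simp only [mul_sub]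
  rw [hs'.tsum_sub hs, h, hz, sub_mul, one_mul, ← tsum_mul_left, mul_zero, zero_add]
  congr 2
  ext n
  ring

/-- The generating function of a function that is constant on blocks of length `B`. -/
lemma one_sub_mul_tsum_div {q : ℝ} (h0 : 0 ≤ q) (h1 : q < 1) {B : ℕ} (hB : 0 < B) {h : ℕ → ℝ}
    {C : ℝ} (hh : ∀ n, |h n| ≤ C) :
    (1 - q) * ∑' n, q ^ n * h (n / B) = (1 - q ^ B) * ∑' j, (q ^ B) ^ j * h j := by
  have : NeZero B := ⟨hB.ne'⟩
  have hs := summable_pow_mul_of_bounded h0 h1 (ψ := fun n => h (n / B)) fun n => hh _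
  have e : ∀ x : ℕ × Fin B, q ^ ((Nat.divModEquiv B).symm x) * h ((Nat.divModEquiv B).symm x / B)
      = (q ^ B) ^ x.1 * h x.1 * q ^ (x.2 : ℕ) := by
    rintro ⟨j, r⟩
    have : ((Nat.divModEquiv B).symm (j, r)) = j * B + r := by simp [Nat.divModEquiv]
    rw [this, Nat.add_comm, Nat.add_mul_div_right _ _ hB, Nat.div_eq_of_lt r.2, zero_add]
    ring
  rw [← (Nat.divModEquiv B).symm.tsum_eq (fun n => q ^ n * h (n / B))]
  have hs' := (Nat.divModEquiv B).symm.summable_iff.2 hs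
  simp only [Function.comp_def, e] at hs'
  simp only [e]
  rw [hs'.tsum_prod]
  simp only [tsum_fintype, ← Finset.mul_sum, Fin.sum_univ_eq_sum_range (fun i => q ^ i)]
  rw [tsum_mul_right, ← geom_sum_mul_neg]
  ring

lemma interp_succ_sub {B : ℕ} (hB : 0 < B) (ψ : ℕ → ℝ) (n : ℕ) :
    interp B ψ (n + 1) - interp B ψ n = ψ (n / B + 1) - ψ (n / B) := by
  have hr := Nat.mod_lt n hB
  have hn := Nat.div_add_mod n B
  by_cases h : n % B + 1 = B
  · have e1 : (n + 1) / B = n / B + 1 := by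
      rw [show n + 1 = B * (n / B + 1) by rw [mul_add]; omega, Nat.mul_div_cancel_left _ hB]
    have e2 : (n + 1) % B = 0 := by
      rw [show n + 1 = B * (n / B + 1) by rw [mul_add]; omega, Nat.mul_mod_right]
    have e3 : ((n % B : ℕ) : ℝ) = B - 1 := by
      rw [eq_sub_iff_add_eq]; exact_mod_cast h
    rw [interp, interp, e1, e2, e3]
    push_cast; ring
  · have e1 : (n + 1) / B = n / B := by
      rw [show n + 1 = (n % B + 1) + B * (n / B) by omega, Nat.add_mul_div_left _ _ hB,
        Nat.div_eq_of_lt (by omega), zero_add]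
    have e2 : (n + 1) % B = n % B + 1 := by
      conv_lhs => rw [show n + 1 = (n % B + 1) + B * (n / B) by omega]
      rw [Nat.add_mul_mod_self_left, Nat.mod_eq_of_lt (by omega)]
    rw [interp, interp, e1, e2]
    push_cast; ring

lemma abs_interp_le {B : ℕ} (hB : 0 < B) {ψ : ℕ → ℝ} {C : ℝ} (hψ : ∀ n, |ψ n| ≤ C) (n : ℕ) :
    |interp B ψ n| ≤ B * C := by
  have hr : ((n % B : ℕ) : ℝ) ≤ B := by exact_mod_cast (Nat.mod_lt n hB).le
  have hr0 : (0 : ℝ) ≤ (n % B : ℕ) := Nat.cast_nonneg _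
  obtain ⟨a1, a2⟩ := abs_le.1 (hψ (n / B))
  obtain ⟨b1, b2⟩ := abs_le.1 (hψ (n / B + 1))
  rw [interp, abs_le]
  constructor <;> nlinarith

lemma interp_zero (B : ℕ) {ψ : ℕ → ℝ} (hz : ψ 0 = 0) : interp B ψ 0 = 0 := by
  simp [interp, hz]

lemma interp_interp {B : ℕ} {K : ℕ} (hK : 0 < K) (ψ : ℕ → ℝ) :
    interp B (interp K ψ) = interp (K * B) ψ := by
  ext n
  rw [interp, interp_succ_sub hK, interp, interp, Nat.mul_comm K B, ← Nat.div_div_eq_div_mul,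
    Nat.mod_mul]
  push_cast
  ring

/-- Interpolation at step `B` amounts to replacing `q` by `q ^ B`: a block of `B` rows is
empty with probability `q ^ B`. -/
lemma abelSum_interp {q : ℝ} (h0 : 0 ≤ q) (h1 : q < 1) {B : ℕ} (hB : 0 < B) {ψ : ℕ → ℝ} {C : ℝ}
    (hψ : ∀ n, |ψ n| ≤ C) (hz : ψ 0 = 0) : abelSum q (interp B ψ) = abelSum (q ^ B) ψ := by
  have h0' : 0 ≤ q ^ B := pow_nonneg h0 B
  have h1' : q ^ B < 1 := pow_lt_one₀ h0 h1 hB.ne'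
  have hd : ∀ n, |ψ (n + 1) - ψ n| ≤ C + C := fun n =>
    (abs_sub _ _).trans (add_le_add (hψ _) (hψ _))
  rw [abelSum, abelSum, sq, mul_assoc,
    one_sub_mul_tsum_succ h0 h1 (abs_interp_le hB hψ) (interp_zero B hz)]
  simp only [interp_succ_sub hB]
  rw [one_sub_mul_tsum_div h0 h1 hB (h := fun j => ψ (j + 1) - ψ j) hd, sq, mul_assoc,
    one_sub_mul_tsum_succ h0' h1' hψ hz]

/-! ### The ideal cost of a column -/

/-- The number of `i < M` for which the reflected digit of cardinality `M` differs at positions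
`i` and `i + n`. -/
noncomputable def unequalPairs (M n : ℕ) : ℝ :=
  M - evenDist 1 n - M * (if 2 * M ∣ n then 1 else 0)

lemma unequalPairs_zero (M : ℕ) : unequalPairs M 0 = 0 := by
  simp [unequalPairs, evenDist]

lemma abs_unequalPairs_le (M n : ℕ) : |unequalPairs M n| ≤ M + 1 := by
  have h1 : (evenDist 1 n : ℝ) ≤ 1 := by exact_mod_cast evenDist_le 1 n
  have h2 : (0 : ℝ) ≤ evenDist 1 n := Nat.cast_nonneg _
  have h3 : (0 : ℝ) ≤ M := Nat.cast_nonneg _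
  rw [unequalPairs, abs_le]
  split_ifs <;> constructor <;> linarith

/-- Interpolating the indicator of the odd numbers gives a triangle wave. -/
lemma interp_evenDist_one {m : ℕ} (hm : 0 < m) (n : ℕ) :
    interp m (fun j => (evenDist 1 j : ℝ)) n = evenDist m n := by
  have hr := Nat.mod_lt n hm
  have e : n % (2 * m) = n % m + m * (n / m % 2) := by rw [Nat.mul_comm, Nat.mod_mul]
  have hr' : ((n % m : ℕ) : ℝ) ≤ m := by exact_mod_cast hr.le
  rw [interp]
  simp only [evenDist, e]
  rcases Nat.mod_two_eq_zero_or_one (n / m) with h | h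
  · have h' : (n / m + 1) % 2 = 1 := by omega
    rw [h, h']
    have : min (n % m + m * 0) (2 * m - (n % m + m * 0)) = n % m := by omega
    rw [this]; simp
  · have h' : (n / m + 1) % 2 = 0 := by omega
    rw [h, h']
    have : min (n % m + m * 1) (2 * m - (n % m + m * 1)) = m - n % m := by omega
    rw [this, Nat.cast_sub hr.le]; simp; ring

/-- Interpolating a comb gives a row of tents. -/
lemma interp_dvd {M K : ℕ} (hM : 0 < M) (hK : 0 < K) (n : ℕ) :
    interp M (fun j => if 2 * K ∣ j then 1 else 0) n
      = max ((M : ℝ) - evenDist (M * K) n) 0 := by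
  have hr := Nat.mod_lt n hM
  have e : n % (2 * (M * K)) = n % M + M * (n / M % (2 * K)) := by
    rw [show 2 * (M * K) = M * (2 * K) by ring, Nat.mod_mul]
  have ht := Nat.mod_lt (n / M) (show 0 < 2 * K by omega)
  have e' : 2 * K ∣ n / M + 1 ↔ n / M % (2 * K) + 1 = 2 * K := by
    rw [Nat.dvd_iff_mod_eq_zero, Nat.add_mod, Nat.mod_eq_of_lt (show 1 < 2 * K by omega)]
    constructor
    · intro h
      by_contra h'
      rw [Nat.mod_eq_of_lt (by omega)] at h
      omega
    · intro h; rw [h, Nat.mod_self]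
  rw [interp]
  simp only [evenDist, e, e', Nat.dvd_iff_mod_eq_zero (n := n / M)]
  generalize n / M % (2 * K) = t at *
  generalize n % M = r at *
  have hMK : M ≤ M * K := Nat.le_mul_of_pos_right M hK
  rcases Nat.eq_zero_or_pos t with rfl | ht0
  · rw [show min (r + M * 0) (2 * (M * K) - (r + M * 0)) = r by omega, if_pos rfl,
      if_neg (by omega), max_eq_left (by rw [sub_nonneg]; exact_mod_cast hr.le)]
    ring
  rw [if_neg ht0.ne']
  by_cases h : t + 1 = 2 * K
  · have h2 : M * (t + 1) = 2 * (M * K) := by rw [h]; ring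
    have h3 : M * 1 ≤ M * t := Nat.mul_le_mul_left M ht0
    rw [mul_add] at h2
    rw [if_pos h, show min (r + M * t) (2 * (M * K) - (r + M * t)) = M - r by omega,
      Nat.cast_sub hr.le, max_eq_left (by simp)]
    ring
  · have h2 : M * (t + 2) ≤ 2 * (M * K) := by
      rw [show 2 * (M * K) = M * (2 * K) by ring]; exact Nat.mul_le_mul_left M (by omega)
    have h3 : M * 1 ≤ M * t := Nat.mul_le_mul_left M ht0
    rw [mul_add] at h2
    rw [if_neg h, max_eq_right]
    · ring
    · rw [sub_nonpos, Nat.cast_le]; omega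

lemma exchangeDefect_eq {M K : ℕ} (hM : 0 < M) (hK : 0 < K) (n : ℕ) :
    interp M (unequalPairs K) n + K * unequalPairs M n
      - (interp K (unequalPairs M) n + M * unequalPairs K n) = exchangeDefect M K n := by
  have h : ∀ a b : ℕ, 0 < a → 0 < b → interp a (unequalPairs b) n
      = a * b - evenDist a n - b * max ((a : ℝ) - evenDist (a * b) n) 0 := by
    intro a b ha hb
    rw [← interp_evenDist_one ha, ← interp_dvd ha hb]
    simp only [interp, unequalPairs]
    ring
  rw [h M K hM hK, h K M hK hM, exchangeDefect, unequalPairs, unequalPairs, Nat.mul_comm K M]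
  ring

lemma exists_abs_exchangeSpline_le (M K : ℕ) : ∃ C, ∀ n, |exchangeSpline M K n| ≤ C := by
  have h : ∀ (m : ℕ) (p : ℕ → ℝ), ∃ C, ∀ n, |p (evenDist m n)| ≤ C := fun m p =>
    ⟨∑ r ∈ Finset.range (m + 1), |p r|, fun n =>
      Finset.single_le_sum (f := fun r => |p r|) (fun _ _ => abs_nonneg _)
        (Finset.mem_range.2 (Nat.lt_succ_of_le (evenDist_le m n)))⟩
  obtain ⟨C₁, h₁⟩ := h (M * K) fun r => tentSpline M K r
  obtain ⟨C₂, h₂⟩ := h K fun r => sawCubic M K r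
  obtain ⟨C₃, h₃⟩ := h M fun r => sawCubic M K r
  obtain ⟨C₄, h₄⟩ := h 1 fun r => ((K : ℝ) - M) / 4 * r
  refine ⟨C₁ + C₂ + C₃ + C₄, fun n => ?_⟩
  rw [exchangeSpline]
  refine (abs_add_le _ _).trans (add_le_add ?_ (h₄ n))
  refine (abs_sub _ _).trans (add_le_add ?_ (h₃ n))
  exact (abs_add_le _ _).trans (add_le_add (h₁ n) (h₂ n))

/-- Two summations by parts turn the defect into the nonnegative exchange spline. -/
lemma abelSum_exchangeDefect_nonneg {y : ℝ} (h0 : 0 ≤ y) (h1 : y < 1) {M K : ℕ} (hM : 2 ≤ M)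
    (hMK : M ≤ K) : 0 ≤ abelSum y (exchangeDefect M K) := by
  obtain ⟨C, hC⟩ := exists_abs_exchangeSpline_le M K
  have hd : ∀ n, |exchangeSpline M K (n + 1) - exchangeSpline M K n| ≤ C + C := fun n =>
    (abs_sub _ _).trans (add_le_add (hC _) (hC _))
  have e : ∀ n, exchangeDefect M K (n + 1) = (exchangeSpline M K (n + 1 + 1)
      - exchangeSpline M K (n + 1)) - (exchangeSpline M K (n + 1) - exchangeSpline M K n) := by
    intro n
    rw [← exchangeSpline_second_difference hM hMK]
    ring
  rw [abelSum]
  refine mul_nonneg (sq_nonneg _) ?_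
  simp only [e]
  rw [← one_sub_mul_tsum_succ h0 h1 hd
    (by rw [exchangeSpline_one hM hMK, exchangeSpline_zero, sub_zero]),
    ← one_sub_mul_tsum_succ h0 h1 (ψ := fun n => exchangeSpline M K (n + 1)) (fun n => hC _)
    (exchangeSpline_one hM hMK)]
  exact mul_nonneg (by linarith) (mul_nonneg (by linarith)
    (tsum_nonneg fun n => mul_nonneg (pow_nonneg h0 n) (exchangeSpline_nonneg hM hMK _)))

/-- The expected number of transitions, per combination of values of the preceding columns, in a
column of cardinality `M` that is followed by columns with `B` combinations of values, if the
table is continued periodically beyond its last row. -/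
noncomputable def columnCost (q : ℝ) (M B : ℕ) : ℝ := abelSum q (interp B (unequalPairs M))

/-- It costs no more to put the column of smaller cardinality first. -/
theorem columnCost_exchange {q : ℝ} (h0 : 0 ≤ q) (h1 : q < 1) {M K P : ℕ} (hM : 2 ≤ M)
    (hMK : M ≤ K) (hP : 0 < P) :
    columnCost q M (K * P) + M * columnCost q K P
      ≤ columnCost q K (M * P) + K * columnCost q M P := by
  have hM0 : 0 < M := by omega
  have hK0 : 0 < K := by omega
  have h0' : 0 ≤ q ^ P := pow_nonneg h0 P
  have h1' : q ^ P < 1 := pow_lt_one₀ h0 h1 hP.ne'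
  have hb : ∀ m, ∀ n, |unequalPairs m n| ≤ m + 1 := abs_unequalPairs_le
  have hbM := abs_interp_le hM0 (hb K)
  have hbK := abs_interp_le hK0 (hb M)
  simp only [columnCost]
  rw [← interp_interp hK0, ← interp_interp hM0,
    abelSum_interp h0 h1 hP hbM (interp_zero _ (unequalPairs_zero _)),
    abelSum_interp h0 h1 hP hbK (interp_zero _ (unequalPairs_zero _)),
    abelSum_interp h0 h1 hP (hb M) (unequalPairs_zero _),
    abelSum_interp h0 h1 hP (hb K) (unequalPairs_zero _), ← sub_nonneg]
  have key := abelSum_exchangeDefect_nonneg h0' h1' hM hMK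
  have s : ∀ {ψ : ℕ → ℝ} {C : ℝ}, (∀ n, |ψ n| ≤ C) → HasSum (fun n => (q ^ P) ^ n * ψ (n + 1))
      (∑' n, (q ^ P) ^ n * ψ (n + 1)) := fun {ψ C} h =>
    (summable_pow_mul_of_bounded h0' h1' (ψ := fun n => ψ (n + 1)) fun n => h _).hasSum
  have := (((s hbM).add ((s (hb M)).mul_left (K : ℝ))).sub
    ((s hbK).add ((s (hb K)).mul_left (M : ℝ)))).tsum_eq
  rw [abelSum, (tsum_congr fun n => by rw [← exchangeDefect_eq hM0 hK0]; ring).trans this] at key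
  simp only [abelSum]
  linarith

/-! ### Sorting the columns -/

/-- The total ideal cost of a table whose columns have the listed cardinalities. -/
noncomputable def tableCost (q : ℝ) : List ℕ → ℝ
  | [] => 0
  | M :: l => columnCost q M l.prod + M * tableCost q l

lemma tableCost_orderedInsert_le {q : ℝ} (h0 : 0 ≤ q) (h1 : q < 1) {M : ℕ} (hM : 2 ≤ M) :
    ∀ {l : List ℕ}, (∀ K ∈ l, 2 ≤ K) →
      tableCost q (l.orderedInsert (· ≤ ·) M) ≤ tableCost q (M :: l)
  | [], _ => le_rfl
  | K :: l, hl => by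
    rw [List.orderedInsert_cons]
    split_ifs with h
    · exact le_rfl
    have hl' : ∀ K ∈ l, 2 ≤ K := fun K hK => hl K (List.mem_cons_of_mem _ hK)
    have ih := tableCost_orderedInsert_le h0 h1 hM hl'
    have hK : 2 ≤ K := hl K List.mem_cons_self
    have hP : 0 < l.prod := List.prod_pos fun K hK => by have := hl' K hK; omega
    have ex := columnCost_exchange h0 h1 hK (not_le.1 h).le hP
    rw [tableCost, (List.perm_orderedInsert (· ≤ ·) M l).prod_eq, List.prod_cons]
    have := mul_le_mul_of_nonneg_left ih (Nat.cast_nonneg (α := ℝ) K)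
    simp only [tableCost, List.prod_cons] at this ⊢
    linarith

lemma tableCost_insertionSort_le {q : ℝ} (h0 : 0 ≤ q) (h1 : q < 1) :
    ∀ {l : List ℕ}, (∀ K ∈ l, 2 ≤ K) → tableCost q (l.insertionSort (· ≤ ·)) ≤ tableCost q l
  | [], _ => le_rfl
  | M :: l, hl => by
    have hl' : ∀ K ∈ l, 2 ≤ K := fun K hK => hl K (List.mem_cons_of_mem _ hK)
    have ih := tableCost_insertionSort_le h0 h1 hl'
    refine (tableCost_orderedInsert_le h0 h1 (hl M List.mem_cons_self)
      fun K hK => hl' K ((List.mem_insertionSort _).1 hK)).trans ?_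
    rw [tableCost, tableCost, (List.perm_insertionSort (· ≤ ·) l).prod_eq]
    have := mul_le_mul_of_nonneg_left ih (Nat.cast_nonneg (α := ℝ) M)
    linarith

/-- Among all orders of the same cardinalities, the increasing one has the least ideal cost. -/
theorem tableCost_le_of_perm {q : ℝ} (h0 : 0 ≤ q) (h1 : q < 1) {l l' : List ℕ}
    (hl : ∀ K ∈ l, 2 ≤ K) (hs : l'.Pairwise (· ≤ ·)) (hp : l'.Perm l) :
    tableCost q l' ≤ tableCost q l := by
  have : l' = l.insertionSort (· ≤ ·) :=
    (hp.trans (List.perm_insertionSort (· ≤ ·) l).symm).eq_of_pairwise' hs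
      (List.pairwise_insertionSort (· ≤ ·) l)
  rw [this]
  exact tableCost_insertionSort_le h0 h1 hl

/-! ### The reflected digits of a Gray code -/

/-- The digit, of cardinality `M`, that goes up and down alternately:
`0, 1, …, M - 1, M - 1, …, 1, 0, 0, 1, …`. -/
def wave (M i : ℕ) : ℕ := if Even (i / M) then i % M else M - 1 - i % M

lemma wave_lt {M : ℕ} (hM : 0 < M) (i : ℕ) : wave M i < M := by
  have := Nat.mod_lt i hM
  unfold wave
  split_ifs <;> omega

lemma wave_of_lt {M i : ℕ} (h : i < M) : wave M i = i := by
  simp [wave, Nat.div_eq_of_lt h, Nat.mod_eq_of_lt h]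

lemma wave_add_self {M : ℕ} (hM : 0 < M) (i : ℕ) : wave M (i + M) = M - 1 - wave M i := by
  have := Nat.mod_lt i hM
  simp only [wave, Nat.add_div_right _ hM, Nat.add_mod_right,
    Nat.even_add_one]
  split_ifs <;> omega

lemma wave_add_eq_iff {M r : ℕ} (hr : r < M) (n : ℕ) :
    wave M r = wave M (r + n) ↔ 2 * M ∣ n ∨ 2 * M ∣ 2 * r + n + 1 := by
  have hM : 0 < M := by omega
  have ht := Nat.mod_lt (r + n) (show 0 < 2 * M by omega)
  have hs := Nat.mod_lt (r + n) hM
  have h1 : (r + n) % (2 * M) = (r + n) % M + M * ((r + n) / M % 2) := by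
    rw [Nat.mul_comm, Nat.mod_mul]
  have hw : wave M r = wave M (r + n) ↔
      (r + n) % (2 * M) = r ∨ (r + n) % (2 * M) = 2 * M - 1 - r := by
    rw [wave_of_lt hr, h1, wave]
    rcases Nat.mod_two_eq_zero_or_one ((r + n) / M) with h | h
    · rw [if_pos (Nat.even_iff.2 h), h]; omega
    · rw [if_neg (by rw [Nat.even_iff]; omega), h]; omega
  rw [hw]
  have h2 := Nat.div_add_mod (r + n) (2 * M)
  generalize (r + n) % (2 * M) = t at *
  generalize (r + n) / (2 * M) = k at *
  have e1 : 2 * M ∣ n ↔ t = r := by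
    constructor
    · rintro ⟨l, rfl⟩
      have h3 := congrArg (· % (2 * M)) h2
      simp only [Nat.mul_add_mod, Nat.add_mul_mod_self_left] at h3
      rwa [Nat.mod_eq_of_lt ht, Nat.mod_eq_of_lt (by omega)] at h3
    · rintro rfl
      exact ⟨k, by omega⟩
  have e2 : 2 * M ∣ 2 * r + n + 1 ↔ t = 2 * M - 1 - r := by
    rw [show 2 * r + n + 1 = 2 * M * k + (t + r + 1) by omega,
      Nat.dvd_add_right (Nat.dvd_mul_right _ _)]
    constructor
    · rintro ⟨l, hl⟩
      have : l = 1 := by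
        rcases Nat.lt_or_ge l 1 with h | h
        · obtain rfl : l = 0 := by omega
          omega
        · by_contra h'
          have : 2 * M * 2 ≤ 2 * M * l := Nat.mul_le_mul_left _ (by omega)
          omega
      subst this
      omega
    · rintro rfl
      exact ⟨1, by omega⟩
  rw [e1, e2]

/-- For odd `n` there is exactly one `r < M` whose mirror image is `r + n`, for even `n` none. -/
lemma sum_dvd_eq {M : ℕ} (hM : 0 < M) (n : ℕ) :
    ∑ r ∈ Finset.range M, (if 2 * M ∣ 2 * r + n + 1 then 1 else 0 : ℝ) = evenDist 1 n := by
  rcases Nat.even_or_odd' n with ⟨k, rfl | rfl⟩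
  · rw [Finset.sum_eq_zero]
    · simp [evenDist]
    · intro r _
      rw [if_neg]
      intro h
      have := (Dvd.intro M rfl : 2 ∣ 2 * M).trans h
      omega
  · have hd : ∀ r, 2 * M ∣ 2 * r + (2 * k + 1) + 1 ↔ M ∣ r + (k + 1) := fun r => by
      rw [show 2 * r + (2 * k + 1) + 1 = 2 * (r + (k + 1)) by ring,
        Nat.mul_dvd_mul_iff_left two_pos]
    simp only [hd]
    have hk := Nat.div_add_mod (k + 1) M
    have hk' := Nat.mod_lt (k + 1) hM
    generalize (k + 1) % M = s at *
    generalize (k + 1) / M = l at *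
    have key : ∀ r < M, (M ∣ r + (k + 1) ↔ r = if s = 0 then 0 else M - s) := by
      intro r hr
      rw [← hk, show r + (M * l + s) = M * l + (r + s) by ring,
        Nat.dvd_add_right (Nat.dvd_mul_right _ _)]
      constructor
      · rintro ⟨t, ht⟩
        have : t < 2 := by
          by_contra h'
          have : M * 2 ≤ M * t := Nat.mul_le_mul_left _ (by omega)
          omega
        interval_cases t <;> split_ifs <;> omega
      · rintro rfl
        split_ifs with h
        · simp [h]
        · exact ⟨1, by omega⟩
    rw [Finset.sum_congr rfl fun r hr => by rw [if_congr (key r (Finset.mem_range.1 hr)) rfl rfl],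
      Finset.sum_ite_eq', if_pos]
    · have : (2 * k + 1) % 2 = 1 := by omega
      simp [evenDist, this]
    · rw [Finset.mem_range]; split_ifs <;> omega

/-- The closed form `unequalPairs` is the count of unequal pairs. -/
lemma sum_wave_ne {M : ℕ} (hM : 0 < M) (n : ℕ) :
    ∑ r ∈ Finset.range M, (if wave M r = wave M (r + n) then 0 else 1 : ℝ)
      = unequalPairs M n := by
  have h : ∀ r ∈ Finset.range M, (if wave M r = wave M (r + n) then 0 else 1 : ℝ)
      = 1 - (if 2 * M ∣ n then 1 else 0) - (if 2 * M ∣ 2 * r + n + 1 then 1 else 0) := by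
    intro r hr
    rw [if_congr (wave_add_eq_iff (Finset.mem_range.1 hr) n) rfl rfl]
    by_cases h1 : 2 * M ∣ n
    · have h2 : ¬ 2 * M ∣ 2 * r + n + 1 := by
        intro h2
        have h1 := (Dvd.intro M rfl : 2 ∣ 2 * M).trans h1
        have h2 := (Dvd.intro M rfl : 2 ∣ 2 * M).trans h2
        omega
      simp [h1, h2]
    · by_cases h2 : 2 * M ∣ 2 * r + n + 1 <;> simp [h1, h2]
  rw [Finset.sum_congr rfl h, Finset.sum_sub_distrib, sum_dvd_eq hM]
  simp [unequalPairs]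
  ring

lemma sum_range_mul_eq {α : Type*} [AddCommMonoid α] (f : ℕ → α) (n B : ℕ) :
    ∑ a ∈ Finset.range (n * B), f a
      = ∑ i ∈ Finset.range n, ∑ s ∈ Finset.range B, f (i * B + s) := by
  induction n with
  | zero => simp
  | succ n ih => rw [Nat.succ_mul, Finset.sum_range_add, ih, Finset.sum_range_succ]

lemma sum_wave_ne_periodic {M : ℕ} (hM : 0 < M) (n d : ℕ) :
    ∑ i ∈ Finset.range (n * M), (if wave M i = wave M (i + d) then 0 else 1 : ℝ)
      = n * unequalPairs M d := by
  have h : ∀ i r, (if wave M (i * M + r) = wave M (i * M + r + d) then 0 else 1 : ℝ)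
      = if wave M r = wave M (r + d) then 0 else 1 := by
    intro i r
    induction i with
    | zero => simp
    | succ i ih =>
      rw [← ih, show (i + 1) * M + r = i * M + r + M by ring,
        show i * M + r + M + d = i * M + r + d + M by ring, wave_add_self hM, wave_add_self hM]
      have h1 := wave_lt hM (i * M + r)
      have h2 := wave_lt hM (i * M + r + d)
      exact if_congr (by omega) rfl rfl
  rw [sum_range_mul_eq]
  simp only [h, sum_wave_ne hM, Finset.sum_const, Finset.card_range, nsmul_eq_mul]

/-- The number of unequal pairs of entries at distance `d` in a column of cardinality `M` that is
followed by columns with `B` combinations of values and preceded by columns with `n`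
combinations. -/
lemma sum_wave_div_ne {M B : ℕ} (hM : 0 < M) (hB : 0 < B) (n d : ℕ) :
    ∑ a ∈ Finset.range (n * M * B),
        (if wave M (a / B) = wave M ((a + d) / B) then 0 else 1 : ℝ)
      = n * interp B (unequalPairs M) d := by
  have hr := Nat.mod_lt d hB
  have hd := Nat.div_add_mod d B
  have key : ∀ i, ∑ s ∈ Finset.range B,
      (if wave M ((i * B + s) / B) = wave M ((i * B + s + d) / B) then 0 else 1 : ℝ)
      = (B - (d % B : ℕ)) * (if wave M i = wave M (i + d / B) then 0 else 1 : ℝ)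
        + (d % B : ℕ) * (if wave M i = wave M (i + (d / B + 1)) then 0 else 1 : ℝ) := by
    intro i
    have e1 : ∀ s < B, (i * B + s) / B = i := fun s hs => by
      rw [Nat.add_comm, Nat.add_mul_div_right _ _ hB, Nat.div_eq_of_lt hs, zero_add]
    have e2 : ∀ s < B - d % B, (i * B + s + d) / B = i + d / B := fun s hs => by
      rw [show i * B + s + d = (s + d % B) + (i + d / B) * B by
          conv_lhs => rw [← hd]
          ring,
        Nat.add_mul_div_right _ _ hB, Nat.div_eq_of_lt (by omega), zero_add]
    have e3 : ∀ s < d % B, (i * B + (B - d % B + s) + d) / B = i + (d / B + 1) := fun s hs => by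
      rw [show i * B + (B - d % B + s) + d = s + (i + (d / B + 1)) * B by
          have : (i + (d / B + 1)) * B = i * B + B * (d / B) + B := by ring
          omega,
        Nat.add_mul_div_right _ _ hB, Nat.div_eq_of_lt (by omega), zero_add]
    have hsplit : B = (B - d % B) + d % B := by omega
    rw [Finset.sum_congr rfl fun s hs => by rw [e1 s (Finset.mem_range.1 hs)]]
    conv_lhs => rw [hsplit]
    rw [Finset.sum_range_add]
    congr 1
    · rw [Finset.sum_congr rfl fun s hs => by rw [← hsplit, e2 s (Finset.mem_range.1 hs)]]
      rw [Finset.sum_const, Finset.card_range, nsmul_eq_mul, Nat.cast_sub hr.le]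
    · rw [Finset.sum_congr rfl fun s hs => by rw [← hsplit, e3 s (Finset.mem_range.1 hs)]]
      rw [Finset.sum_const, Finset.card_range, nsmul_eq_mul]
  rw [sum_range_mul_eq, Finset.sum_congr rfl fun i _ => key i, Finset.sum_add_distrib,
    ← Finset.mul_sum, ← Finset.mul_sum, sum_wave_ne_periodic hM, sum_wave_ne_periodic hM, interp]
  ring

/-! ### Enumerating all rows in Gray-code order -/

/-- The parity of a quotient is that of the next quotient plus the reflected digit. -/
lemma even_iff_even_div_add_wave {M : ℕ} (hM : 0 < M) (i : ℕ) :
    Even i ↔ Even (i / M + wave M i) := by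
  have h1 := Nat.div_add_mod i M
  have h2 := Nat.mod_lt i hM
  rw [wave]
  generalize i / M = k at *
  generalize i % M = r at *
  subst h1
  split_ifs with h
  · simp [Nat.even_add, h]
  · obtain ⟨t, rfl⟩ : ∃ t, M = r + 1 + t := ⟨M - (r + 1), by omega⟩
    rw [show r + 1 + t - 1 - r = t by omega]
    simp only [Nat.even_add, Nat.even_mul, h, Nat.not_even_one, or_false]
    tauto

/-- The number of combinations of values in the columns from position `k` on. -/
def tailProd {c : ℕ} (N : Fin c → ℕ) (k : ℕ) : ℕ :=
  ∏ i ∈ (Finset.univ.filter fun i : Fin c => k ≤ (i : ℕ)), N i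

lemma tailProd_pos {c : ℕ} {N : Fin c → ℕ} (hN : ∀ i, 0 < N i) (k : ℕ) : 0 < tailProd N k :=
  Finset.prod_pos fun i _ => hN i

lemma tailProd_eq_mul {c : ℕ} (N : Fin c → ℕ) (j : Fin c) :
    tailProd N j = tailProd N (j + 1) * N j := by
  have : (Finset.univ.filter fun i : Fin c => (j : ℕ) ≤ i)
      = insert j (Finset.univ.filter fun i : Fin c => (j : ℕ) + 1 ≤ i) := by
    ext i
    simp only [Finset.mem_filter, Finset.mem_univ, true_and, Finset.mem_insert, Fin.ext_iff]
    omega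
  rw [tailProd, this, Finset.prod_insert (by simp), Nat.mul_comm, tailProd]

lemma tailProd_self {c : ℕ} (N : Fin c → ℕ) : tailProd N c = 1 := by
  rw [tailProd, Finset.filter_false_of_mem, Finset.prod_empty]
  intro i _
  have := i.2
  omega

lemma tailProd_zero {c : ℕ} (N : Fin c → ℕ) : tailProd N 0 = ∏ i, N i := by
  simp [tailProd]

/-- The row at position `a` in the reflected Gray-code enumeration of all rows. -/
def grayRow {c : ℕ} {N : Fin c → ℕ} (hN : ∀ i, 0 < N i) (a : ℕ) : Row N := fun j =>
  ⟨wave (N j) (a / tailProd N (j + 1)), wave_lt (hN j) _⟩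

/-- The parity of the digits before position `k` is that of the number of complete passes through
the columns from position `k` on. -/
lemma even_div_tailProd_iff {c : ℕ} {N : Fin c → ℕ} (hN : ∀ i, 0 < N i) {a : ℕ}
    (ha : a < ∏ i, N i) : ∀ k ≤ c, (Even (a / tailProd N k) ↔
      Even (∑ i ∈ (Finset.univ.filter fun i : Fin c => (i : ℕ) < k), (grayRow hN a i : ℕ)))
  | 0, _ => by simp [tailProd_zero, Nat.div_eq_of_lt ha]
  | k + 1, hk => by
    have ih := even_div_tailProd_iff hN ha k (by omega)
    have hs : (Finset.univ.filter fun i : Fin c => (i : ℕ) < k + 1)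
        = insert ⟨k, hk⟩ (Finset.univ.filter fun i : Fin c => (i : ℕ) < k) := by
      ext i
      simp only [Finset.mem_filter, Finset.mem_univ, true_and, Finset.mem_insert, Fin.ext_iff]
      omega
    have ht := tailProd_eq_mul N ⟨k, hk⟩
    rw [hs, Finset.sum_insert (by simp), Nat.even_add, ← ih,
      even_iff_even_div_add_wave (hN ⟨k, hk⟩), Nat.div_div_eq_div_mul, ← ht, Nat.even_add]
    exact iff_comm

/-- `grayRow` enumerates the rows in increasing Gray-code order. -/
lemma grayRow_lt {c : ℕ} {N : Fin c → ℕ} (hN : ∀ i, 0 < N i) {a b : ℕ} (hab : a < b)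
    (hb : b < ∏ i, N i) : GrayLT (grayRow hN a) (grayRow hN b) := by
  have ha := hab.trans hb
  -- the first column at which the quotients of `a` and `b` differ
  have hex : ∃ k, a / tailProd N k ≠ b / tailProd N k := ⟨c, by simp [tailProd_self, hab.ne]⟩
  classical
  have hk := Nat.find_spec hex
  have hmin : ∀ i < Nat.find hex, a / tailProd N i = b / tailProd N i := fun i hi =>
    not_not.1 (Nat.find_min hex hi)
  have hkc : Nat.find hex ≤ c := Nat.find_min' hex (by simp [tailProd_self, hab.ne])
  generalize Nat.find hex = k at *
  cases k with
  | zero => simp [tailProd_zero, Nat.div_eq_of_lt ha, Nat.div_eq_of_lt hb] at hk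
  | succ k =>
    have hpar := even_div_tailProd_iff hN ha k (by omega)
    have hq := hmin k (by omega)
    have ht := tailProd_eq_mul N ⟨k, hkc⟩
    refine ⟨⟨k, hkc⟩, fun i hi => ?_, ?_⟩
    · have hi' : (i : ℕ) < k := hi
      simp only [grayRow, hmin (i + 1) (by omega)]
    have hset : Finset.Iio (⟨k, hkc⟩ : Fin c)
        = Finset.univ.filter fun i : Fin c => (i : ℕ) < k := by
      ext i; simp [Fin.lt_def]
    have hlt : a / tailProd N (k + 1) < b / tailProd N (k + 1) :=
      lt_of_le_of_ne (Nat.div_le_div_right hab.le) hk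
    simp only at ht
    rw [ht, ← Nat.div_div_eq_div_mul, ← Nat.div_div_eq_div_mul] at hq
    rw [ht, ← Nat.div_div_eq_div_mul] at hpar
    rw [hset, if_congr hpar.symm rfl rfl]
    simp only [grayRow, Fin.lt_def, wave, ← hq]
    generalize a / tailProd N (k + 1) = x at *
    generalize b / tailProd N (k + 1) = y at *
    have hx := Nat.div_add_mod x (N ⟨k, hkc⟩)
    have hy := Nat.div_add_mod y (N ⟨k, hkc⟩)
    have hx' := Nat.mod_lt x (hN ⟨k, hkc⟩)
    have hy' := Nat.mod_lt y (hN ⟨k, hkc⟩)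
    rw [← hq] at hy
    split_ifs <;> omega

lemma grayRow_injOn {c : ℕ} {N : Fin c → ℕ} (hN : ∀ i, 0 < N i) :
    Set.InjOn (grayRow hN) (Finset.range (∏ i, N i)) := by
  intro a ha b hb hab
  simp only [Finset.coe_range, Set.mem_Iio] at ha hb
  rcases lt_trichotomy a b with h | h | h
  · exact absurd (hab ▸ grayRow_lt hN h hb) (GrayLT.irrefl _)
  · exact h
  · exact absurd (hab ▸ grayRow_lt hN h ha) (GrayLT.irrefl _)

lemma exists_grayRow_eq {c : ℕ} {N : Fin c → ℕ} (hN : ∀ i, 0 < N i) (s : Row N) :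
    ∃ a < ∏ i, N i, grayRow hN a = s := by
  classical
  have h : (Finset.range (∏ i, N i)).image (grayRow hN) = Finset.univ := by
    rw [← Finset.card_eq_iff_eq_univ, Finset.card_image_of_injOn (grayRow_injOn hN)]
    simp
  have hs : s ∈ (Finset.range (∏ i, N i)).image (grayRow hN) := h ▸ Finset.mem_univ s
  simpa using hs

/-- The sorted table lists the present rows in the order of their Gray-code positions. -/
lemma sort_grayLE {c : ℕ} {N : Fin c → ℕ} (hN : ∀ i, 0 < N i) (T : Finset (Row N)) :
    T.sort GrayLE
      = ((List.range (∏ i, N i)).filter fun a => grayRow hN a ∈ T).map (grayRow hN) := by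
  have hpw : (((List.range (∏ i, N i)).filter fun a => grayRow hN a ∈ T).map
      (grayRow hN)).Pairwise GrayLT := by
    rw [List.pairwise_map]
    have h := (List.pairwise_lt_range (n := ∏ i, N i)).filter fun a => grayRow hN a ∈ T
    refine h.imp_of_mem fun {a b} _ hb hab => grayRow_lt hN hab ?_
    exact List.mem_range.1 (List.mem_of_mem_filter hb)
  refine List.Perm.eq_of_pairwise' (r := GrayLE) (Finset.pairwise_sort T GrayLE)
    (hpw.imp Or.inr) ?_
  rw [List.perm_ext_iff_of_nodup (Finset.sort_nodup T GrayLE)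
    (hpw.imp fun {s t} (h : GrayLT s t) (e : s = t) => GrayLT.irrefl t (e ▸ h))]
  intro s
  simp only [Finset.mem_sort, List.mem_map, List.mem_filter, List.mem_range, decide_eq_true_eq]
  constructor
  · intro hs
    obtain ⟨a, ha, rfl⟩ := exists_grayRow_eq hN s
    exact ⟨a, ⟨ha, hs⟩, rfl⟩
  · rintro ⟨a, ⟨_, h⟩, rfl⟩
    exact h

/-! ### Runs of a filtered enumeration -/

lemma runs_append_singleton {α : Type*} [DecidableEq α] (l : List α) (x : α) :
    runs (l ++ [x]) = runs l + if l.getLast? = some x then 0 else 1 := by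
  have h : ∀ (l : List α) (a : α), ((l ++ [x]).destutter' (· ≠ ·) a).length
      = (l.destutter' (· ≠ ·) a).length + if (a :: l).getLast? = some x then 0 else 1 := by
    intro l
    induction l with
    | nil => intro a; by_cases h : a = x <;> simp [h]
    | cons b l ih =>
      intro a
      rw [List.cons_append, List.destutter'_cons, List.destutter'_cons, List.getLast?_cons_cons]
      split_ifs with h1 h2 h2
      · rw [List.length_cons, List.length_cons, ih, if_pos h2]
      · rw [List.length_cons, List.length_cons, ih, if_neg h2]
      · rw [not_not] at h1; subst h1; rw [ih, if_pos h2]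
      · rw [not_not] at h1; subst h1; rw [ih, if_neg h2]
  cases l with
  | nil => simp [runs]
  | cons a l => exact h l a

lemma getLast?_filter_range (P : ℕ → Prop) [DecidablePred P] (n : ℕ) (a : ℕ) :
    ((List.range n).filter P).getLast? = some a ↔
      a < n ∧ P a ∧ ∀ k, a < k → k < n → ¬ P k := by
  induction n with
  | zero => simp
  | succ n ih =>
    rw [List.range_succ, List.filter_append]
    by_cases h : P n
    · simp only [List.filter_singleton, h, decide_true, List.getLast?_append,
        List.getLast?_singleton, Option.some_or, Option.some.injEq, cond_true]
      constructor
      · rintro rfl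
        exact ⟨Nat.lt_succ_self _, h, fun k h1 h2 => by omega⟩
      · rintro ⟨h1, _, h3⟩
        by_contra h4
        exact h3 n (by omega) (Nat.lt_succ_self n) h
    · simp only [List.filter_singleton, h, decide_false, cond_false, List.append_nil]
      rw [ih]
      constructor
      · rintro ⟨h1, h2, h3⟩
        refine ⟨by omega, h2, fun k h4 h5 => ?_⟩
        rcases (Nat.lt_succ_iff.1 h5).eq_or_lt with rfl | h6
        · exact h
        · exact h3 k h4 h6
      · rintro ⟨h1, h2, h3⟩
        refine ⟨?_, h2, fun k h4 h5 => h3 k h4 (by omega)⟩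
        rcases (Nat.lt_succ_iff.1 h1).eq_or_lt with rfl | h6
        · exact absurd h2 h
        · exact h6

open Classical in
/-- The runs of a list are counted by its nonemptiness and its unequal consecutive pairs. -/
lemma runs_filter_range {α : Type*} [DecidableEq α] (w : ℕ → α) (P : ℕ → Prop) (n : ℕ) :
    (runs (((List.range n).filter P).map w) : ℝ)
      = (if ∃ a < n, P a then 1 else 0) + ∑ b ∈ Finset.range n, ∑ a ∈ Finset.range b,
        (if P a ∧ P b ∧ ∀ k, a < k → k < b → ¬ P k then 1 else 0)
          * (if w a = w b then 0 else 1) := by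
  induction n with
  | zero => simp [runs]
  | succ n ih =>
    rw [List.range_succ, List.filter_append, Finset.sum_range_succ]
    by_cases h : P n
    · simp only [List.filter_singleton, h, decide_true, cond_true, List.map_append, List.map_cons,
        List.map_nil, true_and]
      have hn : ∃ a < n + 1, P a := ⟨n, Nat.lt_succ_self n, h⟩
      rw [runs_append_singleton, Nat.cast_add, ih, if_pos hn]
      by_cases hex : ∃ a < n, P a
      · rw [if_pos hex]
        have hne : (List.range n).filter P ≠ [] := by
          obtain ⟨a, h1, h2⟩ := hex
          exact List.ne_nil_of_mem (List.mem_filter.2 ⟨List.mem_range.2 h1, by simpa using h2⟩)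
        have hm := List.getLast?_eq_some_getLast hne
        obtain ⟨h1, h2, h3⟩ := (getLast?_filter_range P n _).1 hm
        generalize ((List.range n).filter P).getLast hne = m at *
        have hlast : ∑ a ∈ Finset.range n, (if P a ∧ ∀ k, a < k → k < n → ¬ P k then 1 else 0)
            * (if w a = w n then 0 else 1) = (if w m = w n then 0 else 1 : ℝ) := by
          rw [Finset.sum_eq_single m]
          · rw [if_pos ⟨h2, h3⟩, one_mul]
          · intro a ha ham
            rw [if_neg, zero_mul]
            rintro ⟨h4, h5⟩
            rcases lt_or_gt_of_ne ham with h6 | h6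
            · exact h5 m h6 h1 h2
            · exact h3 a h6 (Finset.mem_range.1 ha) h4
          · intro h4; exact absurd (Finset.mem_range.2 h1) h4
        rw [List.getLast?_map, hm, hlast]
        simp
        ring
      · rw [if_neg hex]
        have hlast : ∑ a ∈ Finset.range n, (if P a ∧ ∀ k, a < k → k < n → ¬ P k then 1 else 0)
            * (if w a = w n then 0 else 1) = (0 : ℝ) := by
          refine Finset.sum_eq_zero fun a ha => ?_
          rw [if_neg, zero_mul]
          rintro ⟨h4, _⟩
          exact hex ⟨a, Finset.mem_range.1 ha, h4⟩
        have hnil : (List.range n).filter P = [] := by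
          rw [List.filter_eq_nil_iff]
          intro a ha h2
          exact hex ⟨a, List.mem_range.1 ha, by simpa using h2⟩
        rw [hnil, hlast]
        simp
        ring
    · have hex : (∃ a < n + 1, P a) ↔ ∃ a < n, P a := by
        constructor
        · rintro ⟨a, h1, h2⟩
          rcases (Nat.lt_succ_iff.1 h1).eq_or_lt with rfl | h6
          · exact absurd h2 h
          · exact ⟨a, h6, h2⟩
        · rintro ⟨a, h1, h2⟩
          exact ⟨a, by omega, h2⟩
      simp only [List.filter_singleton, h, decide_false, cond_false, List.append_nil, ih, hex]
      simp

/-! ### Expectations over the random table -/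

open MeasureTheory ProbabilityTheory

/-- The probability that all elements of `A` and no elements of `B` are present. -/
lemma setBernoulli_real_cylinder {ι : Type*} (p : unitInterval) {A B : Finset ι}
    (hAB : Disjoint A B) :
    (setBernoulli Set.univ p).real {T : Set ι | (∀ i ∈ A, i ∈ T) ∧ ∀ i ∈ B, i ∉ T}
      = (p : ℝ) ^ A.card * (1 - p) ^ B.card := by
  classical
  have hset : (fun f : ι → Prop => {i | f i}) ⁻¹'
      {T : Set ι | (∀ i ∈ A, i ∈ T) ∧ ∀ i ∈ B, i ∉ T}
      = Set.pi (A ∪ B : Finset ι) fun i => if i ∈ A then {True} else {False} := by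
    ext f
    simp only [Set.mem_preimage, Set.mem_ofPred_eq, Set.mem_pi, Finset.mem_coe, Finset.mem_union]
    constructor
    · rintro ⟨h1, h2⟩ i hi
      by_cases hA : i ∈ A
      · simp [hA, h1 i hA]
      · simp [hA, h2 i (hi.resolve_left hA)]
    · intro h
      refine ⟨fun i hi => ?_, fun i hi => ?_⟩
      · simpa [hi] using h i (Or.inl hi)
      · simpa [Finset.disjoint_right.1 hAB hi] using h i (Or.inr hi)
  rw [measureReal_def, setBernoulli_apply', hset, Measure.infinitePi_pi _ (fun i _ => by
    split_ifs <;> exact MeasurableSet.of_discrete), Finset.prod_union hAB,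
    Finset.prod_congr rfl fun i hi => by rw [if_pos hi],
    Finset.prod_congr (s₁ := B) rfl fun i hi => by rw [if_neg (Finset.disjoint_right.1 hAB hi)]]
  simp

lemma integral_ite_setBernoulli {ι : Type*} [Finite ι] (p : unitInterval) (E : Set ι → Prop)
    [DecidablePred E] :
    ∫ T : Set ι, (if E T then 1 else 0 : ℝ) ∂(setBernoulli Set.univ p)
      = (setBernoulli Set.univ p).real {T | E T} := by
  classical
  rw [← integral_indicator_one (Set.toFinite _).measurableSet]
  simp [Set.indicator_apply]

open Classical in
/-- The expected number of runs along an enumeration of the possible rows: a run starts at the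
first present row and at each present row whose predecessor has a different entry. -/
lemma integral_runs {ι α : Type*} [Finite ι] [DecidableEq α] (p : unitInterval) {n : ℕ}
    {e : ℕ → ι} (he : Set.InjOn e (Finset.range n)) (w : ℕ → α) :
    ∫ T : Set ι, (runs (((List.range n).filter fun a => e a ∈ T).map w) : ℝ)
        ∂(setBernoulli Set.univ p)
      = (1 - (1 - (p : ℝ)) ^ n) + ∑ b ∈ Finset.range n, ∑ a ∈ Finset.range b,
        (p : ℝ) ^ 2 * (1 - p) ^ (b - a - 1) * (if w a = w b then 0 else 1) := by
  simp only [runs_filter_range w]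
  rw [integral_add .of_finite .of_finite, integral_finsetSum _ fun _ _ => .of_finite]
  congr 1
  · rw [integral_ite_setBernoulli p fun T : Set ι => ∃ a < n, e a ∈ T]
    have h : {T : Set ι | ∃ a < n, e a ∈ T}
        = {T : Set ι | (∀ i ∈ (∅ : Finset ι), i ∈ T) ∧
            ∀ i ∈ (Finset.range n).image e, i ∉ T}ᶜ := by
      ext T; simp
    rw [h, probReal_compl_eq_one_sub (Set.toFinite _).measurableSet,
      setBernoulli_real_cylinder p (Finset.disjoint_empty_left _),
      Finset.card_image_of_injOn he]
    simp
  · refine Finset.sum_congr rfl fun b hb => ?_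
    rw [integral_finsetSum _ fun _ _ => .of_finite]
    refine Finset.sum_congr rfl fun a ha => ?_
    rw [Finset.mem_range] at hb ha
    rw [integral_mul_const, integral_ite_setBernoulli p fun T : Set ι =>
      e a ∈ T ∧ e b ∈ T ∧ ∀ k, a < k → k < b → e k ∉ T]
    congr 1
    have h : {T : Set ι | e a ∈ T ∧ e b ∈ T ∧ ∀ k, a < k → k < b → e k ∉ T}
        = {T : Set ι | (∀ i ∈ ({a, b} : Finset ℕ).image e, i ∈ T) ∧
            ∀ i ∈ (Finset.Ioo a b).image e, i ∉ T} := by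
      ext T
      simp only [Finset.forall_mem_image]
      simp [and_assoc]
    have hsub1 : (({a, b} : Finset ℕ) : Set ℕ) ⊆ Finset.range n := by
      intro k; simp; omega
    have hsub2 : ((Finset.Ioo a b : Finset ℕ) : Set ℕ) ⊆ Finset.range n := by
      intro k; simp; omega
    rw [h, setBernoulli_real_cylinder, Finset.card_image_of_injOn (he.mono hsub1),
      Finset.card_image_of_injOn (he.mono hsub2), Finset.card_pair ha.ne, Nat.card_Ioo]
    rw [Finset.disjoint_left]
    intro i hi hi'
    obtain ⟨k, hk, rfl⟩ := Finset.mem_image.1 hi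
    obtain ⟨l, hl, hkl⟩ := Finset.mem_image.1 hi'
    have := he (hsub2 hl) (hsub1 hk) hkl
    subst this
    simp at hk hl
    omega

/-- The expected number of runs of a table, column by column. -/
lemma expectedRuns_eq_sum {c : ℕ} {N : Fin c → ℕ} (hN : ∀ i, 0 < N i) (p : unitInterval)
    (σ : Equiv.Perm (Fin c)) :
    expectedRuns N p σ = ∑ j, ((1 - (1 - (p : ℝ)) ^ (∏ i, N i))
      + ∑ b ∈ Finset.range (∏ i, N i), ∑ a ∈ Finset.range b,
        (p : ℝ) ^ 2 * (1 - p) ^ (b - a - 1) *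
          (if wave (N (σ j)) (a / tailProd (fun i => N (σ i)) (j + 1))
            = wave (N (σ j)) (b / tailProd (fun i => N (σ i)) (j + 1)) then 0 else 1)) := by
  classical
  have hN' : ∀ i, 0 < N (σ i) := fun i => hN _
  have hprod : ∏ i, N (σ i) = ∏ i, N i := Equiv.prod_comp σ N
  let f := Equiv.piCongrLeft (fun i => Fin (N i)) σ
  have hmem : ∀ (T : Set (Row N)) [Fintype T] (s : Row fun i => N (σ i)),
      s ∈ permuteColumns σ T.toFinset ↔ f s ∈ T := by
    intro T _ s
    have hf : ∀ t : Row N, (fun j => t (σ j)) = f.symm t := fun t => by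
      ext j; simp [f]
    rw [permuteColumns, Finset.mem_image]
    constructor
    · rintro ⟨t, ht, rfl⟩
      rw [hf, Equiv.apply_symm_apply]
      simpa using ht
    · intro h
      exact ⟨f s, by simpa using h, by rw [hf, Equiv.symm_apply_apply]⟩
  have hinj : Set.InjOn (fun a => f (grayRow hN' a)) (Finset.range (∏ i, N i)) := by
    rw [← hprod]
    exact f.injective.comp_injOn (grayRow_injOn hN')
  rw [expectedRuns]
  simp only [grayRunCount, sort_grayLE hN', hprod, List.map_map, Nat.cast_sum, hmem]
  rw [integral_finsetSum _ fun _ _ => .of_finite]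
  refine Finset.sum_congr rfl fun j _ => ?_
  have := integral_runs p hinj ((fun t => t j) ∘ grayRow hN')
  convert this using 5
  simp [grayRow]

/-! ### Comparison of the expected and the ideal number of runs -/

/-- Cutting off the pairs that leave `[0, n)` costs at most the probability `1 - q ^ n` that the
table is not empty: there is at most one pair of consecutive present rows across `n`. -/
lemma sum_pairs_bounds {q : ℝ} (h0 : 0 ≤ q) (h1 : q < 1) {δ : ℕ → ℕ → ℝ}
    (hδ0 : ∀ a b, 0 ≤ δ a b) (hδ1 : ∀ a b, δ a b ≤ 1) (n : ℕ) :
    let fin := ∑ b ∈ Finset.range n, ∑ a ∈ Finset.range b,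
      (1 - q) ^ 2 * q ^ (b - a - 1) * δ a b
    let inf := ∑ a ∈ Finset.range n, (1 - q) ^ 2 * ∑' d, q ^ d * δ a (a + (d + 1))
    fin ≤ inf ∧ inf ≤ fin + (1 - q ^ n) := by
  intro fin inf
  have hfin : fin = ∑ a ∈ Finset.range n,
      (1 - q) ^ 2 * ∑ d ∈ Finset.range (n - 1 - a), q ^ d * δ a (a + (d + 1)) := by
    have hcomm : fin = ∑ a ∈ Finset.range n, ∑ b ∈ Finset.Ico (a + 1) n,
        (1 - q) ^ 2 * q ^ (b - a - 1) * δ a b :=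
      Finset.sum_comm' fun b a => by
        simp only [Finset.mem_range, Finset.mem_Ico]; omega
    rw [hcomm]
    refine Finset.sum_congr rfl fun a _ => ?_
    rw [Finset.sum_Ico_eq_sum_range, Finset.mul_sum, show n - (a + 1) = n - 1 - a by omega]
    refine Finset.sum_congr rfl fun d _ => ?_
    rw [show a + 1 + d - a - 1 = d by omega, show a + 1 + d = a + (d + 1) by ring, mul_assoc]
  have hb : ∀ a b, |δ a b| ≤ 1 := fun a b => by rw [abs_of_nonneg (hδ0 a b)]; exact hδ1 a b
  have hs : ∀ a, Summable fun d => q ^ d * δ a (a + (d + 1)) := fun a =>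
    summable_pow_mul_of_bounded h0 h1 (ψ := fun d => δ a (a + (d + 1))) fun d => hb a _
  have hsplit : ∀ a, ∑' d, q ^ d * δ a (a + (d + 1))
      = ∑ d ∈ Finset.range (n - 1 - a), q ^ d * δ a (a + (d + 1))
        + ∑' d, q ^ (d + (n - 1 - a)) * δ a (a + (d + (n - 1 - a) + 1)) := fun a =>
    ((hs a).sum_add_tsum_nat_add (n - 1 - a)).symm
  have htail0 : ∀ a, 0 ≤ ∑' d, q ^ (d + (n - 1 - a)) * δ a (a + (d + (n - 1 - a) + 1)) := fun a =>
    tsum_nonneg fun d => mul_nonneg (pow_nonneg h0 _) (hδ0 _ _)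
  have htail1 : ∀ a, ∑' d, q ^ (d + (n - 1 - a)) * δ a (a + (d + (n - 1 - a) + 1))
      ≤ q ^ (n - 1 - a) * (1 - q)⁻¹ := by
    intro a
    rw [← tsum_geometric_of_lt_one h0 h1, ← tsum_mul_left]
    refine Summable.tsum_le_tsum (fun d => ?_) ((summable_nat_add_iff (n - 1 - a)).2 (hs a))
      ((summable_geometric_of_lt_one h0 h1).mul_left _)
    rw [pow_add, mul_comm (q ^ d)]
    exact mul_le_of_le_one_right (by positivity) (hδ1 _ _)
  constructor
  · rw [hfin]
    refine Finset.sum_le_sum fun a _ => mul_le_mul_of_nonneg_left ?_ (sq_nonneg _)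
    rw [hsplit]
    linarith [htail0 a]
  · have hgeom : ∑ a ∈ Finset.range n, (1 - q) * q ^ (n - 1 - a) = 1 - q ^ n := by
      rw [Finset.sum_range_reflect (fun i => (1 - q) * q ^ i) n, ← Finset.mul_sum, mul_comm]
      exact geom_sum_mul_neg q n
    rw [hfin, ← hgeom, ← Finset.sum_add_distrib]
    refine Finset.sum_le_sum fun a _ => ?_
    rw [hsplit, mul_add]
    refine add_le_add le_rfl ?_
    calc (1 - q) ^ 2 * _ ≤ (1 - q) ^ 2 * (q ^ (n - 1 - a) * (1 - q)⁻¹) :=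
          mul_le_mul_of_nonneg_left (htail1 a) (sq_nonneg _)
      _ = (1 - q) * q ^ (n - 1 - a) := by
          have : 1 - q ≠ 0 := by linarith
          field_simp

/-- The expected number of runs of one column is at least its ideal cost and exceeds it by at
most one. -/
lemma column_bounds {q : ℝ} (h0 : 0 ≤ q) (h1 : q < 1) {M B : ℕ} (hM : 0 < M) (hB : 0 < B) (n : ℕ) :
    let runs := (1 - q ^ (n * M * B)) + ∑ b ∈ Finset.range (n * M * B), ∑ a ∈ Finset.range b,
      (1 - q) ^ 2 * q ^ (b - a - 1) * (if wave M (a / B) = wave M (b / B) then 0 else 1)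
    n * columnCost q M B ≤ runs ∧ runs ≤ n * columnCost q M B + 1 := by
  intro runs
  obtain ⟨hl, hu⟩ := sum_pairs_bounds h0 h1
    (δ := fun a b => if wave M (a / B) = wave M (b / B) then 0 else 1)
    (fun a b => by positivity) (fun a b => by split_ifs <;> norm_num) (n * M * B)
  have hcost : ∑ a ∈ Finset.range (n * M * B), (1 - q) ^ 2 * ∑' d, q ^ d *
      (if wave M (a / B) = wave M ((a + (d + 1)) / B) then 0 else 1 : ℝ)
      = n * columnCost q M B := by
    rw [← Finset.mul_sum, ← Summable.tsum_finsetSum]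
    · simp only [← Finset.mul_sum, sum_wave_div_ne hM hB]
      simp only [mul_left_comm _ (n : ℝ), tsum_mul_left, columnCost, abelSum]
    · intro a _
      refine summable_pow_mul_of_bounded h0 h1 (C := 1)
        (ψ := fun d => if wave M (a / B) = wave M ((a + (d + 1)) / B) then 0 else 1) fun d => ?_
      split_ifs <;> norm_num
  have hq : 0 ≤ q ^ (n * M * B) := pow_nonneg h0 _
  simp only [hcost] at hl hu
  constructor <;> simp only [runs] <;> linarith

/-- The number of combinations of values in the columns before position `k`. -/
def headProd {c : ℕ} (N : Fin c → ℕ) (k : ℕ) : ℕ :=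
  ∏ i ∈ (Finset.univ.filter fun i : Fin c => (i : ℕ) < k), N i

lemma headProd_mul_tailProd {c : ℕ} (N : Fin c → ℕ) (j : Fin c) :
    headProd N j * N j * tailProd N (j + 1) = ∏ i, N i := by
  rw [mul_assoc, mul_comm (N j), ← tailProd_eq_mul, headProd, tailProd,
    ← Finset.prod_filter_mul_prod_filter_not Finset.univ (fun i : Fin c => (i : ℕ) < j)]
  simp only [not_lt]

/-- The recursive cost, column by column. -/
lemma tableCost_ofFn (q : ℝ) : ∀ {c : ℕ} (N : Fin c → ℕ), tableCost q (List.ofFn N)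
    = ∑ j : Fin c, (headProd N j : ℝ) * columnCost q (N j) (tailProd N (j + 1))
  | 0, N => by simp [tableCost]
  | c + 1, N => by
    have ht0 : tailProd N 1 = (List.ofFn fun i : Fin c => N i.succ).prod := by
      rw [tailProd, Finset.prod_filter, Fin.prod_univ_succ, List.prod_ofFn]
      simp
    have ht : ∀ k, tailProd N (k + 1 + 1) = tailProd (fun i : Fin c => N i.succ) (k + 1) := by
      intro k
      rw [tailProd, tailProd, Finset.prod_filter, Finset.prod_filter, Fin.prod_univ_succ]
      simp
    have hh : ∀ k, headProd N (k + 1) = N 0 * headProd (fun i : Fin c => N i.succ) k := by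
      intro k
      rw [headProd, headProd, Finset.prod_filter, Finset.prod_filter, Fin.prod_univ_succ]
      simp
    have hh0 : headProd N 0 = 1 := by simp [headProd]
    rw [List.ofFn_succ, tableCost, tableCost_ofFn, Fin.sum_univ_succ, ← ht0, Finset.mul_sum]
    simp only [Fin.val_zero, Fin.val_succ, hh0, ht, hh, zero_add, Nat.cast_one, one_mul,
      Nat.cast_mul, mul_assoc]

/-- The expected number of runs differs from the ideal cost by at most one per column, and always in
the same direction. -/
lemma expectedRuns_bounds {c : ℕ} {N : Fin c → ℕ} (hN : ∀ i, 0 < N i) {p : unitInterval}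
    (hp : 0 < (p : ℝ)) (σ : Equiv.Perm (Fin c)) :
    tableCost (1 - p) (List.ofFn fun i => N (σ i)) ≤ expectedRuns N p σ ∧
      expectedRuns N p σ ≤ tableCost (1 - p) (List.ofFn fun i => N (σ i)) + c := by
  have h0 : (0 : ℝ) ≤ 1 - p := sub_nonneg.2 p.2.2
  have h1 : 1 - (p : ℝ) < 1 := by linarith
  have hN' : ∀ i, 0 < N (σ i) := fun i => hN _
  have hcol := fun j : Fin c => column_bounds h0 h1 (hN' j) (tailProd_pos hN' (j + 1))
    (headProd (fun i => N (σ i)) j)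
  have hprod : ∀ j : Fin c,
      headProd (fun i => N (σ i)) j * N (σ j) * tailProd (fun i => N (σ i)) (j + 1)
      = ∏ i, N i := fun j =>
    (headProd_mul_tailProd (fun i => N (σ i)) j).trans (Equiv.prod_comp σ N)
  simp only [hprod, sub_sub_cancel] at hcol
  rw [expectedRuns_eq_sum hN, tableCost_ofFn]
  refine ⟨Finset.sum_le_sum fun j _ => (hcol j).1, ?_⟩
  refine (Finset.sum_le_sum fun j _ => (hcol j).2).trans ?_
  rw [Finset.sum_add_distrib]
  simp

end GrayRuns

theorem mainTheorem5 (c : ℕ) (N : Fin c → ℕ) (hmono : Monotone N)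
    (hN : ∀ i, 2 ≤ N i ∧ N i ≤ 30) (p : unitInterval) (σ : Equiv.Perm (Fin c)) :
    GrayRuns.expectedRuns N p (Equiv.refl (Fin c)) ≤ GrayRuns.expectedRuns N p σ + c := by
  have hpos : ∀ i, 0 < N i := fun i => by have := (hN i).1; omega
  rcases p.2.1.eq_or_lt with hp | hp
  · -- for `p = 0` the table is empty, and the geometric series of the ideal cost diverges
    rw [GrayRuns.expectedRuns_eq_sum hpos, GrayRuns.expectedRuns_eq_sum hpos, ← hp]
    simp
  have hcost : GrayRuns.tableCost (1 - p) (List.ofFn N)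
      ≤ GrayRuns.tableCost (1 - p) (List.ofFn fun i => N (σ i)) := by
    refine GrayRuns.tableCost_le_of_perm (sub_nonneg.2 p.2.2) (by linarith) ?_ ?_
      (Equiv.Perm.ofFn_comp_perm σ N).symm
    · intro K hK
      obtain ⟨i, rfl⟩ := (List.mem_ofFn' _ _).1 hK
      exact (hN _).1
    · exact List.pairwise_ofFn.2 fun i j hij => hmono hij.le
  calc GrayRuns.expectedRuns N p (Equiv.refl (Fin c))
      ≤ GrayRuns.tableCost (1 - p) (List.ofFn N) + c :=
        (GrayRuns.expectedRuns_bounds hpos hp (Equiv.refl (Fin c))).2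
    _ ≤ GrayRuns.tableCost (1 - p) (List.ofFn fun i => N (σ i)) + c := by linarith
    _ ≤ GrayRuns.expectedRuns N p σ + c := by
        linarith [(GrayRuns.expectedRuns_bounds hpos hp σ).1]
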